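/- Let $k$ be a perfect field, let $n\ge 0$, let $R=k[x_0,\dots,x_n]$ with its standard grading, and let $I\subseteq R$ be a homogeneous radical ideal of dimension $d\ge 0$, where the dimension of $I$ is that of the projective variety it defines, i.e. $\dim I=\dim_{\mathrm{Krull}}(R/I)-1$. Assume that $I$ is unmixed, i.e. that all its associated prime ideals have the same dimension. Let $h_I(m)=\dim_k (R/I)_m$ be the Hilbert function of $I$, let $p_I=a_d t^d+\dots+a_0\in\mathbb{Q}[t]$ be its Hilbert polynomial (the polynomial with $h_I(m)=p_I(m)$ for all large $m$), and let $\deg I=d!\,a_d\in\mathbb{N}$ be the degree of $I$. Then $$h_I(m)\le \binom{m+\deg I+d}{d+1}-\binom{m+d}{d+1}\qquad\text{for all integers } m\ge 1.$$ -/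

import Mathlib

noncomputable section

namespace HomogeneousIdeals

open MvPolynomial

attribute [local instance] MvPolynomial.gradedAlgebra in
/-- `I` is a homogeneous ideal of `k[x₀, …, xₙ]` for the standard grading. -/
def IsHomogeneousIdeal {k : Type*} [Field k] {n : ℕ}
    (I : Ideal (MvPolynomial (Fin (n + 1)) k)) : Prop :=
  I.IsHomogeneous (homogeneousSubmodule (Fin (n + 1)) k)

/-- The Hilbert function `m ↦ dim_k (k[x₀, …, xₙ] / I)_m`. The homogeneous part of degree `m` of the
quotient is the image of the space of homogeneous polynomials of degree `m`. -/
def hilbertFunction {k : Type*} [Field k] {n : ℕ} (I : Ideal (MvPolynomial (Fin (n + 1)) k))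
    (m : ℕ) : ℕ :=
  Module.finrank k
    ((homogeneousSubmodule (Fin (n + 1)) k m).map (Ideal.Quotient.mkₐ k I).toLinearMap)

/-- `p` is a Hilbert polynomial of `I`: it agrees with the Hilbert function at all large `m`.
There is at most one such `p`. -/
def IsHilbertPolynomial {k : Type*} [Field k] {n : ℕ} (I : Ideal (MvPolynomial (Fin (n + 1)) k))
    (p : Polynomial ℚ) : Prop :=
  ∃ m₀ : ℕ, ∀ m : ℕ, m₀ ≤ m → (hilbertFunction I m : ℚ) = p.eval (m : ℚ)

open scoped Classical in
/-- The Hilbert polynomial of `I` (it exists for every homogeneous ideal; the value `0` is used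
where it does not exist). -/
def hilbertPolynomial {k : Type*} [Field k] {n : ℕ} (I : Ideal (MvPolynomial (Fin (n + 1)) k)) :
    Polynomial ℚ :=
  if h : ∃ p : Polynomial ℚ, IsHilbertPolynomial I p then h.choose else 0

/-- `I` has projective dimension `d`, that is, `k[x₀, …, xₙ] / I` has Krull dimension `d + 1`. -/
def HasDim {k : Type*} [Field k] {n : ℕ} (I : Ideal (MvPolynomial (Fin (n + 1)) k))
    (d : ℕ) : Prop :=
  ringKrullDim (MvPolynomial (Fin (n + 1)) k ⧸ I) = (d : WithBot ℕ∞) + 1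

/-- The degree `d! * a_d` of a homogeneous ideal `I` of projective dimension `d ≥ 0`, where `a_d` is
the coefficient of `t ^ d` in the Hilbert polynomial of `I`. This rational number is a positive
integer, so that the floor only turns it into a natural number. -/
def degree {k : Type*} [Field k] {n : ℕ} (I : Ideal (MvPolynomial (Fin (n + 1)) k)) (d : ℕ) : ℕ :=
  ⌊(d.factorial : ℚ) * (hilbertPolynomial I).coeff d⌋₊

/-- `I` is unmixed: all its associated primes (those of the module `k[x₀, …, xₙ] / I`) have the same
dimension. -/
def IsUnmixed {k : Type*} [Field k] {n : ℕ} (I : Ideal (MvPolynomial (Fin (n + 1)) k)) : Prop :=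
  ∀ P ∈ associatedPrimes (MvPolynomial (Fin (n + 1)) k) (MvPolynomial (Fin (n + 1)) k ⧸ I),
    ∀ Q ∈ associatedPrimes (MvPolynomial (Fin (n + 1)) k) (MvPolynomial (Fin (n + 1)) k ⧸ I),
      ringKrullDim (MvPolynomial (Fin (n + 1)) k ⧸ P) =
        ringKrullDim (MvPolynomial (Fin (n + 1)) k ⧸ Q)

end HomogeneousIdeals

end

/-! A sum over $i<\deg I$ of $\binom{m+i+d}{d}$ equals the stated difference of binomials
(`sum_choose_add_choose`), so it is enough to bound $h_I(m)$ by this sum.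

For a homogeneous prime $Q$ over an infinite perfect field, let $L$ be the fraction field of $R/Q$.
Noether normalization gives linear forms $l_0,\dots,l_d$ such that $R/Q$ is integral over $A=k[l]$
and $L$ is separable over $K=k(l)$, together with a linear form $u$ generating $L/K$. Put $r=[L:K]$.
The map $y\mapsto(\mathrm{Tr}(yu^i))_{i<r}$ is injective because the trace form is nondegenerate,
and it sends degree $m$ into $\prod_i A_{m+i}$ because $A$ is integrally closed. This gives the
upper bound (`finrank_formsAt_le_sum`). Independence of the powers of $u$ embeds $\bigoplus_i
A_{m+r-i}u^i$ in degree $m+r$, which bounds $h_Q$ from below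
(`finrank_mul_choose_le_finrank_formsAt`).

For radical $I=\bigcap P_j$, embedding $R/I$ in $\prod R/P_j$ adds the upper bounds up to one sum
with $\sum r_j$ terms. Forms lying in all minimal primes but one add up the lower bounds, and
comparison of leading coefficients yields $\sum r_j\le\deg I$ (`le_degree_of_bounds`). Over a finite
field everything is transferred from the algebraic closure: the extended ideal stays radical, keeps
its Hilbert function, and its minimal primes keep their dimension. -/

namespace HomogeneousIdeals

open MvPolynomial

/-! ### Linear algebra and spaces of forms. -/

section LinearAlgebra

variable {k V W W' : Type*} [Field k] [AddCommGroup V] [Module k V] [AddCommGroup W] [Module k W]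
  [AddCommGroup W'] [Module k W']

/-- Used to compare Hilbert functions by ideal membership alone, without maps between the quotients.
-/
theorem finrank_range_le_of_ker_le [FiniteDimensional k V] (f : V →ₗ[k] W) (g : V →ₗ[k] W')
    (h : LinearMap.ker f ≤ LinearMap.ker g) :
    Module.finrank k (LinearMap.range g) ≤ Module.finrank k (LinearMap.range f) := by
  have h1 := LinearMap.finrank_range_add_finrank_ker f
  have h2 := LinearMap.finrank_range_add_finrank_ker g
  have h3 := Submodule.finrank_mono h
  omega

theorem finrank_range_eq_of_ker_eq [FiniteDimensional k V] (f : V →ₗ[k] W) (g : V →ₗ[k] W')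
    (h : LinearMap.ker f = LinearMap.ker g) :
    Module.finrank k (LinearMap.range g) = Module.finrank k (LinearMap.range f) :=
  (finrank_range_le_of_ker_le f g h.le).antisymm (finrank_range_le_of_ker_le g f h.ge)

end LinearAlgebra

section Homogeneous

variable {σ k : Type*} [Field k]

instance finiteDimensional_homogeneousSubmodule [Finite σ] (m : ℕ) :
    FiniteDimensional k (homogeneousSubmodule σ k m) :=
  Module.Finite.iff_fg.mpr (homogeneousSubmodule_fg σ k m)

theorem finrank_homogeneousSubmodule (d m : ℕ) :
    Module.finrank k (homogeneousSubmodule (Fin (d + 1)) k m) = (m + d).choose d := by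
  classical
  have e : homogeneousSubmodule (Fin (d + 1)) k m ≃ₗ[k]
      Finsupp.supported k k {e : Fin (d + 1) →₀ ℕ | e.degree = m} :=
    (LinearEquiv.ofEq _ _ (homogeneousSubmodule_eq_finsupp_supported _ _ _)).trans
      ((AddMonoidAlgebra.coeffLinearEquiv k).submoduleMap _ |>.trans
        (LinearEquiv.ofEq _ _ (by
          ext x
          simp only [Submodule.mem_map]
          constructor
          · rintro ⟨y, hy, rfl⟩; exact hy
          · intro hx
            exact ⟨AddMonoidAlgebra.ofCoeff x, hx, rfl⟩)))
  have hset : {e : Fin (d + 1) →₀ ℕ | e.degree = m} =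
      ((Finset.univ : Finset (Fin (d + 1))).finsuppAntidiag m : Set _) := by
    ext e
    simp [Finsupp.degree_eq_sum]
  rw [e.finrank_eq, (Finsupp.supportedEquivFinsupp _).finrank_eq]
  rw [hset, Module.finrank_finsupp_self, ← Nat.card_eq_fintype_card]
  simp only [SetLike.coe_sort_coe, Nat.card_eq_fintype_card, Fintype.card_coe,
    Finset.card_finsuppAntidiag_nat_eq_choose, Finset.card_univ, Fintype.card_fin]
  rw [show d + 1 + m - 1 = m + d by omega, Nat.choose_symm_add]

theorem homogeneousComponent_mul_of_isHomogeneous {a : ℕ} {p : MvPolynomial σ k}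
    (hp : p.IsHomogeneous a) (m : ℕ) (f : MvPolynomial σ k) :
    homogeneousComponent (a + m) (p * f) = p * homogeneousComponent m f := by
  let _ := MvPolynomial.gradedAlgebra (σ := σ) (R := k)
  have := DirectSum.coe_decompose_mul_add_of_left_mem (homogeneousSubmodule σ k) (i := a) (j := m)
    (a := p) (b := f) hp
  rwa [show (DirectSum.decompose (homogeneousSubmodule σ k) (p * f) (a + m) : MvPolynomial σ k) =
    homogeneousComponent (a + m) (p * f) from decomposition.decompose'_apply _ _,
    show (DirectSum.decompose (homogeneousSubmodule σ k) f m : MvPolynomial σ k) =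
    homogeneousComponent m f from decomposition.decompose'_apply _ _] at this

end Homogeneous

/-! ### Hilbert functions and existence of the Hilbert polynomial. -/

section HilbertFunction

variable {k : Type*} [Field k] {n : ℕ}

theorem isHomogeneousIdeal_iff {I : Ideal (MvPolynomial (Fin (n + 1)) k)} :
    IsHomogeneousIdeal I ↔ ∀ f ∈ I, ∀ m, homogeneousComponent m f ∈ I := by
  constructor
  · intro h f hf m
    exact homogeneousComponent_mem_of_mem h hf m
  · intro h m f hf
    have := h f hf m
    rwa [← decomposition.decompose'_apply] at this

/-- The map from forms of degree `m` to the quotient by `I`. -/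
noncomputable def formsToQuotient (I : Ideal (MvPolynomial (Fin (n + 1)) k)) (m : ℕ) :
    homogeneousSubmodule (Fin (n + 1)) k m →ₗ[k] (MvPolynomial (Fin (n + 1)) k ⧸ I) :=
  (Ideal.Quotient.mkₐ k I).toLinearMap ∘ₗ (homogeneousSubmodule (Fin (n + 1)) k m).subtype

@[simp] theorem formsToQuotient_apply (I : Ideal (MvPolynomial (Fin (n + 1)) k)) (m : ℕ)
    (f : homogeneousSubmodule (Fin (n + 1)) k m) :
    formsToQuotient I m f = Ideal.Quotient.mk I f := rfl

@[simp] theorem mem_ker_formsToQuotient {I : Ideal (MvPolynomial (Fin (n + 1)) k)} {m : ℕ}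
    {f : homogeneousSubmodule (Fin (n + 1)) k m} :
    f ∈ LinearMap.ker (formsToQuotient I m) ↔ (f : MvPolynomial (Fin (n + 1)) k) ∈ I := by
  rw [LinearMap.mem_ker, formsToQuotient_apply, Ideal.Quotient.eq_zero_iff_mem]

theorem hilbertFunction_eq_finrank_range (I : Ideal (MvPolynomial (Fin (n + 1)) k)) (m : ℕ) :
    hilbertFunction I m = Module.finrank k (LinearMap.range (formsToQuotient I m)) := by
  rw [formsToQuotient, LinearMap.range_comp, Submodule.range_subtype]
  rfl

/-- The quotient ideal `(I : X i)`. -/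
noncomputable def colonVar (I : Ideal (MvPolynomial (Fin (n + 1)) k)) (i : Fin (n + 1)) :
    Ideal (MvPolynomial (Fin (n + 1)) k) :=
  Submodule.comap (LinearMap.mulLeft (MvPolynomial (Fin (n + 1)) k) (X i)) I

theorem mem_colonVar {I : Ideal (MvPolynomial (Fin (n + 1)) k)} {i : Fin (n + 1)}
    {f : MvPolynomial (Fin (n + 1)) k} : f ∈ colonVar I i ↔ X i * f ∈ I := Iff.rfl

theorem le_colonVar (I : Ideal (MvPolynomial (Fin (n + 1)) k)) (i : Fin (n + 1)) :
    I ≤ colonVar I i := fun _ hf ↦ I.mul_mem_left _ hf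

theorem IsHomogeneousIdeal.colonVar {I : Ideal (MvPolynomial (Fin (n + 1)) k)}
    (hI : IsHomogeneousIdeal I) (i : Fin (n + 1)) : IsHomogeneousIdeal (colonVar I i) := by
  rw [isHomogeneousIdeal_iff] at hI ⊢
  intro f hf m
  rw [mem_colonVar, ← homogeneousComponent_mul_of_isHomogeneous (isHomogeneous_X k i)]
  exact hI _ hf _

theorem IsHomogeneousIdeal.sup_span_X {I : Ideal (MvPolynomial (Fin (n + 1)) k)}
    (hI : IsHomogeneousIdeal I) (i : Fin (n + 1)) :
    IsHomogeneousIdeal (I ⊔ Ideal.span {X i}) := by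
  let _ := MvPolynomial.gradedAlgebra (σ := Fin (n + 1)) (R := k)
  refine Ideal.IsHomogeneous.sup hI (Ideal.homogeneous_span _ _ ?_)
  rintro x rfl
  exact ⟨1, isHomogeneous_X k i⟩

/-- Dimension count in the exact sequence $0\to R/(I:x_i)(-1)\to R/I\to R/(I+(x_i))\to0$. -/
theorem hilbertFunction_succ {I : Ideal (MvPolynomial (Fin (n + 1)) k)}
    (hI : IsHomogeneousIdeal I) (i : Fin (n + 1)) (m : ℕ) :
    hilbertFunction I (m + 1) =
      hilbertFunction (colonVar I i) m + hilbertFunction (I ⊔ Ideal.span {X i}) (m + 1) := by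
  set J := I ⊔ Ideal.span {X i} with hJ
  have hIJ : I ≤ J := le_sup_left
  let q : (MvPolynomial (Fin (n + 1)) k ⧸ I) →ₗ[k] (MvPolynomial (Fin (n + 1)) k ⧸ J) :=
    (Ideal.Quotient.factorₐ k hIJ).toLinearMap
  let T := LinearMap.range (formsToQuotient I (m + 1))
  let μ : homogeneousSubmodule (Fin (n + 1)) k m →ₗ[k] (MvPolynomial (Fin (n + 1)) k ⧸ I) :=
    (Ideal.Quotient.mkₐ k I).toLinearMap ∘ₗ (LinearMap.mulLeft k (X i)) ∘ₗ
      (homogeneousSubmodule (Fin (n + 1)) k m).subtype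
  have hμ : ∀ f, μ f = Ideal.Quotient.mk I (X i * (f : MvPolynomial (Fin (n + 1)) k)) :=
    fun _ ↦ rfl
  have h1 : hilbertFunction (colonVar I i) m = Module.finrank k (LinearMap.range μ) := by
    rw [hilbertFunction_eq_finrank_range]
    refine finrank_range_eq_of_ker_eq _ _ ?_
    ext f
    rw [mem_ker_formsToQuotient, mem_colonVar, LinearMap.mem_ker, hμ,
      Ideal.Quotient.eq_zero_iff_mem]
  have h2 : LinearMap.range (q.domRestrict T) = LinearMap.range (formsToQuotient J (m + 1)) := by
    ext y
    constructor
    · rintro ⟨⟨_, f, rfl⟩, rfl⟩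
      exact ⟨f, rfl⟩
    · rintro ⟨f, rfl⟩
      exact ⟨⟨_, f, rfl⟩, rfl⟩
  have h3 : (LinearMap.ker (q.domRestrict T)).map T.subtype = LinearMap.range μ := by
    ext y
    constructor
    · rintro ⟨⟨_, f, rfl⟩, hf, rfl⟩
      have hf' : (f : MvPolynomial (Fin (n + 1)) k) ∈ J := by
        rw [← Ideal.Quotient.eq_zero_iff_mem]
        exact hf
      rw [hJ, Submodule.mem_sup] at hf'
      obtain ⟨a, ha, b, hb, hab⟩ := hf'
      obtain ⟨g, rfl⟩ := Ideal.mem_span_singleton'.mp hb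
      refine ⟨⟨homogeneousComponent m g, homogeneousComponent_mem m g⟩, ?_⟩
      rw [hμ]
      change _ = Ideal.Quotient.mk I (f : MvPolynomial (Fin (n + 1)) k)
      rw [Ideal.Quotient.eq, ← homogeneousComponent_mul_of_isHomogeneous (isHomogeneous_X k i),
        ← homogeneousComponent_eq_self f.2, ← hab, map_add, mul_comm g, add_comm 1 m]
      rw [sub_add_cancel_right]
      exact I.neg_mem (isHomogeneousIdeal_iff.mp hI a ha _)
    · rintro ⟨f, rfl⟩
      have hm : X i * (f : MvPolynomial (Fin (n + 1)) k) ∈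
          homogeneousSubmodule (Fin (n + 1)) k (m + 1) := by
        rw [add_comm m 1]
        exact (isHomogeneous_X k i).mul f.2
      refine ⟨⟨_, ⟨_, hm⟩, rfl⟩, ?_, rfl⟩
      change Ideal.Quotient.mk J (X i * (f : MvPolynomial (Fin (n + 1)) k)) = 0
      rw [Ideal.Quotient.eq_zero_iff_mem]
      exact J.mul_mem_right _ (Ideal.mem_sup_right (Ideal.mem_span_singleton_self _))
  have h4 := LinearMap.finrank_range_add_finrank_ker (q.domRestrict T)
  rw [h2, ← hilbertFunction_eq_finrank_range, ← hilbertFunction_eq_finrank_range,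
    ← LinearMap.finrank_range_of_inj (f := T.subtype.domRestrict (LinearMap.ker (q.domRestrict T)))
      (Subtype.val_injective.comp Subtype.val_injective), LinearMap.range_domRestrict, h3, ← h1]
    at h4
  omega

end HilbertFunction

/-- Bernoulli polynomials sum monomials: $B_{n+1}(x+1)-B_{n+1}(x)=(n+1)x^n$. -/
theorem exists_polynomial_forward_difference (q : Polynomial ℚ) :
    ∃ p : Polynomial ℚ, ∀ x : ℚ, p.eval (x + 1) = p.eval x + q.eval x := by
  induction q using Polynomial.induction_on' with
  | add p q hp hq =>
    obtain ⟨a, ha⟩ := hp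
    obtain ⟨b, hb⟩ := hq
    refine ⟨a + b, fun x ↦ ?_⟩
    simp only [Polynomial.eval_add, ha, hb]
    ring
  | monomial n a =>
    refine ⟨Polynomial.C (a / (n + 1)) * Polynomial.bernoulli (n + 1), fun x ↦ ?_⟩
    have : (n : ℚ) + 1 ≠ 0 := by positivity
    rw [Polynomial.eval_mul, Polynomial.eval_mul, add_comm x, Polynomial.bernoulli_eval_one_add]
    simp
    field_simp

section HilbertPolynomial

variable {k : Type*} [Field k] {n : ℕ}

/-- Noetherian induction along the sequence of `hilbertFunction_succ`, for a variable outside $I$.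
If all variables lie in $I$, then $R/I$ vanishes in positive degrees. -/
theorem exists_isHilbertPolynomial (I : Ideal (MvPolynomial (Fin (n + 1)) k))
    (hI : IsHomogeneousIdeal I) : ∃ p, IsHilbertPolynomial I p := by
  induction I using WellFoundedGT.induction with
  | ind I ih =>
  by_cases hX : ∀ i, X i ∈ I
  · refine ⟨0, 1, fun m hm ↦ ?_⟩
    have : formsToQuotient I m = 0 := by
      ext f
      rw [formsToQuotient_apply, LinearMap.zero_apply, Ideal.Quotient.eq_zero_iff_mem]
      have hle : Ideal.span ((X : _ → MvPolynomial (Fin (n + 1)) k) '' Set.univ) ≤ I := by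
        rw [Ideal.span_le]
        rintro _ ⟨i, -, rfl⟩
        exact hX i
      refine hle (mem_ideal_span_X_image.mpr ?_)
      intro e he
      have hdeg := f.2.degree_eq_sum_deg_support he
      by_contra! h
      have : e = 0 := by ext i; simpa using h i
      subst this
      simp at hdeg
      omega
    rw [hilbertFunction_eq_finrank_range, this, LinearMap.range_zero]
    simp
  · push Not at hX
    obtain ⟨i, hi⟩ := hX
    obtain ⟨p₂, m₂, hp₂⟩ := ih (I ⊔ Ideal.span {X i})
      (lt_of_le_of_ne le_sup_left fun h ↦ hi (h ▸
        Ideal.mem_sup_right (Ideal.mem_span_singleton_self _))) (hI.sup_span_X i)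
    by_cases hc : colonVar I i = I
    -- Here $x_i$ is a nonzerodivisor modulo $I$, so the induction only controls the first
    -- difference; the constant is fixed at `m₂`.
    · obtain ⟨p, hp⟩ := exists_polynomial_forward_difference (p₂.comp (Polynomial.X + 1))
      refine ⟨p + Polynomial.C (hilbertFunction I m₂ - p.eval (m₂ : ℚ)), m₂, fun m hm ↦ ?_⟩
      induction m, hm using Nat.le_induction with
      | base => simp
      | succ m hm ihm =>
        rw [hilbertFunction_succ hI i, hc]
        push_cast
        rw [ihm, hp₂ (m + 1) (by omega)]
        simp only [Polynomial.eval_add, Polynomial.eval_C, hp, Polynomial.eval_comp,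
          Polynomial.eval_X, Polynomial.eval_one]
        push_cast
        ring
    · obtain ⟨p₁, m₁, hp₁⟩ := ih (colonVar I i)
        (lt_of_le_of_ne (le_colonVar I i) (Ne.symm hc)) (hI.colonVar i)
      refine ⟨p₁.comp (Polynomial.X - 1) + p₂, max m₁ m₂ + 1, fun m hm ↦ ?_⟩
      obtain ⟨m, rfl⟩ : ∃ l, m = l + 1 := ⟨m - 1, by omega⟩
      rw [hilbertFunction_succ hI i]
      push_cast
      rw [hp₁ m (by omega), hp₂ (m + 1) (by omega)]
      simp

theorem isHilbertPolynomial_hilbertPolynomial {I : Ideal (MvPolynomial (Fin (n + 1)) k)}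
    (hI : IsHomogeneousIdeal I) : IsHilbertPolynomial I (hilbertPolynomial I) := by
  have h := exists_isHilbertPolynomial I hI
  rw [hilbertPolynomial, dif_pos h]
  exact h.choose_spec

end HilbertPolynomial

/-! ### Restriction of polynomials to lines. -/

section Substitution

variable {k ι B : Type*} [Field k] [CommRing B] [Algebra k B]

/-- The substitution `X j ↦ b j + a j T` of a polynomial along a line. -/
noncomputable def lineSubst (b : ι → B) (a : ι → k) : MvPolynomial ι k →ₐ[k] Polynomial B :=
  aeval fun j ↦ Polynomial.C (b j) + Polynomial.C (algebraMap k B (a j)) * Polynomial.X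

theorem natDegree_coeff_lineSubst_monomial (b : ι → B) (a : ι → k) (d : ι →₀ ℕ) :
    (lineSubst b a (monomial d 1)).natDegree ≤ d.degree ∧
      (lineSubst b a (monomial d 1)).coeff d.degree = algebraMap k B (eval a (monomial d 1)) := by
  induction d using Finsupp.induction_linear with
  | zero => simp [lineSubst]
  | add d e hd he =>
    have h : (monomial (d + e) (1 : k)) = monomial d 1 * monomial e 1 := by simp
    rw [h, map_mul, map_mul, map_mul, map_add Finsupp.degree]
    refine ⟨Polynomial.natDegree_mul_le_of_le hd.1 he.1, ?_⟩
    rw [Polynomial.coeff_mul_add_eq_of_natDegree_le hd.1 he.1, hd.2, he.2]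
  | single j m =>
    have h : (monomial (Finsupp.single j m) (1 : k)) = X j ^ m := by
      rw [X_pow_eq_monomial]
    have h1 : (Polynomial.C (b j) + Polynomial.C (algebraMap k B (a j)) * Polynomial.X).natDegree
        ≤ 1 := by compute_degree
    rw [h, map_pow, lineSubst, aeval_X, Finsupp.degree_single]
    refine ⟨?_, ?_⟩
    · simpa using Polynomial.natDegree_pow_le_of_le m h1
    · have := Polynomial.coeff_pow_of_natDegree_le (m := m) h1
      rw [mul_one] at this
      rw [this]
      simp

/-- The coefficient of $T^e$ depends only on the direction $a$ and is a scalar, so a direction off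
the zero set of the top form makes the restriction monic up to a unit. -/
theorem coeff_lineSubst (b : ι → B) (a : ι → k) (f : MvPolynomial ι k) {e : ℕ}
    (he : f.totalDegree ≤ e) :
    (lineSubst b a f).natDegree ≤ e ∧
      (lineSubst b a f).coeff e = algebraMap k B (eval a (homogeneousComponent e f)) := by
  have hs : ∀ d : ι →₀ ℕ, ∀ c : k, monomial d c = c • monomial d 1 := by
    intro d c; simp [smul_monomial]
  have hf : lineSubst b a f = ∑ d ∈ f.support, coeff d f • lineSubst b a (monomial d 1) := by
    conv_lhs => rw [f.as_sum]
    rw [map_sum]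
    exact Finset.sum_congr rfl fun d _ ↦ by rw [hs, map_smul]
  have hd : ∀ d ∈ f.support, d.degree ≤ e := fun d hd ↦ (le_totalDegree hd).trans he
  constructor
  · rw [hf]
    refine Polynomial.natDegree_sum_le_of_forall_le _ _ fun d hd' ↦ ?_
    exact (Polynomial.natDegree_smul_le _ _).trans
      ((natDegree_coeff_lineSubst_monomial b a d).1.trans (hd d hd'))
  · rw [hf, Polynomial.finsetSum_coeff, homogeneousComponent_apply, Finset.sum_filter, map_sum,
      map_sum]
    refine Finset.sum_congr rfl fun d hd' ↦ ?_
    rw [Polynomial.coeff_smul]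
    obtain ⟨h1, h2⟩ := natDegree_coeff_lineSubst_monomial b a d
    split_ifs with h
    · rw [← h, h2, hs d (coeff d f), smul_eval, map_mul, Algebra.smul_def]
    · rw [Polynomial.coeff_eq_zero_of_natDegree_lt
        (h1.trans_lt (lt_of_le_of_ne (hd d hd') h)), smul_zero, map_zero, map_zero]

theorem derivative_lineSubst [Fintype ι] (b : ι → B) (a : ι → k) (f : MvPolynomial ι k) :
    Polynomial.derivative (lineSubst b a f) =
      ∑ j, Polynomial.C (algebraMap k B (a j)) * lineSubst b a (pderiv j f) := by
  classical
  induction f using MvPolynomial.induction_on with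
  | C c =>
    simp [lineSubst, Polynomial.algebraMap_apply]
  | add p q hp hq =>
    simp only [map_add, hp, hq, mul_add, Finset.sum_add_distrib]
  | mul_X p i hp =>
    have hX : lineSubst b a (X i) =
      Polynomial.C (b i) + Polynomial.C (algebraMap k B (a i)) * Polynomial.X := by simp [lineSubst]
    rw [map_mul, Polynomial.derivative_mul, hp]
    simp only [Derivation.leibniz, map_add, smul_eq_mul, map_mul, mul_add, Finset.sum_add_distrib,
      pderiv_X, Pi.single_apply]
    rw [add_comm]
    congr 1
    · rw [Finset.sum_eq_single i]
      · simp [hX]; ring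
      · intro j _ hj
        simp [hj.symm]
      · simp
    · rw [Finset.sum_mul]
      exact Finset.sum_congr rfl fun j _ ↦ by ring

end Substitution

/-! ### Separable Noether normalization by linear combinations. -/

section NoetherNormalization

variable {k L ι : Type*} [Field k] [Field L] [Algebra k L]

theorem totalDegree_pderiv_lt {f : MvPolynomial ι k} {i : ι} {s : ι →₀ ℕ} (hs : s ∈ f.support)
    (hi : s i ≠ 0) : (pderiv i f).totalDegree < f.totalDegree := by
  have hpos : 0 < f.totalDegree := by
    refine lt_of_lt_of_le ?_ (le_totalDegree hs)
    change 0 < s.degree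
    exact (Nat.pos_of_ne_zero hi).trans_le (Finsupp.le_degree i s)
  rw [totalDegree, Finset.sup_lt_iff hpos]
  intro d hd
  rw [mem_support_iff, coeff_pderiv] at hd
  have h : d + Finsupp.single i 1 ∈ f.support := mem_support_iff.mpr (left_ne_zero_of_mul hd)
  have : (d + Finsupp.single i 1).degree ≤ f.totalDegree := le_totalDegree h
  rw [map_add, Finsupp.degree_single] at this
  exact this

/-- Over a perfect field, a relation of minimal degree has a nonzero partial derivative which
is not a relation. -/
theorem exists_aeval_pderiv_ne_zero [PerfectField k] {a : ι → L} {f : MvPolynomial ι k}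
    (hmin : ∀ g : MvPolynomial ι k, g ≠ 0 → aeval a g = 0 → f.totalDegree ≤ g.totalDegree)
    (hf0 : f ≠ 0) (hfa : aeval a f = 0) : ∃ i, aeval a (pderiv i f) ≠ 0 := by
  obtain ⟨i, s, hs, hsi⟩ : ∃ i, ∃ s ∈ f.support, (s i : k) ≠ 0 := by
    obtain _ | ⟨p, hp, hpk⟩ := CharP.exists' k
    · by_contra! h
      have hC : f = C (coeff 0 f) := by
        rw [← totalDegree_eq_zero_iff_eq_C, totalDegree_eq_zero_iff]
        intro s hs i
        exact_mod_cast h i s hs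
      rw [hC, aeval_C, map_eq_zero] at hfa
      rw [hfa, map_zero] at hC
      exact hf0 hC
    -- As $k$ is perfect, $x\mapsto x^p$ is semilinear along an automorphism of $k$ and preserves
    -- linear independence. Hence a minimal relation cannot have all its exponents divisible by $p$:
    -- taking $p$-th roots would give a smaller one.
    · have : ExpChar k p := .prime hp.out
      have : CharP L p := .of_ringHom_of_ne_zero (algebraMap k L) p hp.out.ne_zero
      obtain ⟨i, s, hs, h⟩ := exists_mem_support_not_dvd_of_forall_totalDegree_le p hp.out
        (fun s hs ↦ by
          apply hs.map_of_injective_injective (frobeniusEquiv k p).symm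
            (frobenius L p).toAddMonoidHom
          · simp
          · simp
          · intro r x
            change ((frobeniusEquiv k p).symm r • x) ^ p = r • x ^ p
            rw [Algebra.smul_def, mul_pow, ← map_pow, frobeniusEquiv_symm_pow_p, Algebra.smul_def])
        hmin hf0 hfa
      exact ⟨i, s, hs, by rwa [Ne, CharP.cast_eq_zero_iff k p]⟩
  have hsi' : s i ≠ 0 := fun h ↦ hsi (by rw [h, Nat.cast_zero])
  refine ⟨i, fun h ↦ ?_⟩
  refine (totalDegree_pderiv_lt hs hsi').not_ge (hmin _ (fun h0 ↦ ?_) h)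
  have := congrArg (coeff (s - Finsupp.single i 1)) h0
  have hle : Finsupp.single i 1 ≤ s := by
    rw [Finsupp.single_le_iff]; omega
  rw [coeff_pderiv, tsub_add_cancel_of_le hle, coeff_zero, mul_eq_zero] at this
  refine this.elim (mem_support_iff.mp hs) fun h2 ↦ hsi ?_
  rw [← h2, Finsupp.tsub_apply, Finsupp.single_eq_same]
  have : s i = (s i - 1) + 1 := by omega
  conv_lhs => rw [this]
  push_cast
  rfl

/-- Write $g=\mu h$ with $\mu$ the minimal polynomial. If $\mu'=0$, then $g'=\mu h'$ vanishes at
$w$. -/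
theorem isSeparable_of_aeval_derivative_ne_zero {K : Type*} [Field K] [Algebra K L] {w : L}
    {g : Polynomial K} (hg : Polynomial.aeval w g = 0)
    (hg' : Polynomial.aeval w (Polynomial.derivative g) ≠ 0) : IsSeparable K w := by
  have hg0 : g ≠ 0 := by rintro rfl; simp at hg'
  have hint : IsIntegral K w := isAlgebraic_iff_isIntegral.mp ⟨g, hg0, hg⟩
  obtain ⟨h, rfl⟩ := minpoly.dvd K w hg
  rw [IsSeparable, Polynomial.separable_iff_derivative_ne_zero (minpoly.irreducible hint)]
  intro h0
  apply hg'
  rw [Polynomial.derivative_mul, h0]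
  simp

theorem isIntegral_of_isUnit_coeff {A : Type*} [CommRing A] [Algebra A L] {w : L}
    {g : Polynomial A} {e : ℕ} (he : g.natDegree ≤ e) {u : A} (hu : u * g.coeff e = 1)
    (hg : Polynomial.aeval w g = 0) : IsIntegral A w := by
  refine ⟨Polynomial.C u * g, Polynomial.monic_of_natDegree_le_of_coeff_eq_one e ?_ ?_, ?_⟩
  · exact (Polynomial.natDegree_C_mul_le _ _).trans he
  · rw [Polynomial.coeff_C_mul, hu]
  · rw [← Polynomial.aeval_def, map_mul, hg, mul_zero]

variable (k) in
/-- Every element of `T` is integral over `k[S]` and separable over `k(S)`. -/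
def IsIntegralSeparableOver (S T : Set L) : Prop :=
  (∀ v ∈ T, IsIntegral (Algebra.adjoin k S) v) ∧
    ∀ v ∈ T, IsSeparable (IntermediateField.adjoin k S) v

theorem IsIntegralSeparableOver.trans {S T U : Set L} (h1 : IsIntegralSeparableOver k S T)
    (h2 : IsIntegralSeparableOver k T U) : IsIntegralSeparableOver k S U := by
  constructor
  · intro v hv
    let C := integralClosure (Algebra.adjoin k S) L
    have hle : Algebra.adjoin k T ≤ C.restrictScalars k := by
      rw [Algebra.adjoin_le_iff]
      exact h1.1
    have hv' : IsIntegral C v := by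
      refine IsIntegral.map_of_comp_eq (Subalgebra.inclusion hle).toRingHom (RingHom.id L) ?_
        (h2.1 v hv)
      rfl
    exact isIntegral_trans v hv'
  · intro v hv
    have hle : IntermediateField.adjoin k T ≤
        (separableClosure (IntermediateField.adjoin k S) L).restrictScalars k := by
      rw [IntermediateField.adjoin_le_iff]
      intro x hx
      exact mem_separableClosure_iff.mpr (h1.2 x hx)
    have := (separableClosure_le_separableClosure_iff k L (IntermediateField.adjoin k S)).mpr hle
    exact mem_separableClosure_iff.mp (this (mem_separableClosure_iff.mpr (h2.2 v hv)))

theorem IsIntegralSeparableOver.span {S T : Set L} (h : IsIntegralSeparableOver k S T) :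
    IsIntegralSeparableOver k S (Submodule.span k T : Set L) := by
  constructor
  · intro v hv
    have : Submodule.span k T ≤
        (Subalgebra.toSubmodule ((integralClosure (Algebra.adjoin k S) L).restrictScalars k)) :=
      Submodule.span_le.mpr h.1
    exact this hv
  · intro v hv
    have : Submodule.span k T ≤ Subalgebra.toSubmodule ((separableClosure
        (IntermediateField.adjoin k S) L).restrictScalars k).toSubalgebra :=
      Submodule.span_le.mpr fun x hx ↦ mem_separableClosure_iff.mpr (h.2 x hx)
    exact mem_separableClosure_iff.mp (this hv)

theorem isIntegralSeparableOver_self (S : Set L) : IsIntegralSeparableOver k S S :=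
  ⟨fun v hv ↦ isIntegral_algebraMap (x := (⟨v, Algebra.subset_adjoin hv⟩ : Algebra.adjoin k S)),
    fun v hv ↦ isSeparable_algebraMap
      (⟨v, IntermediateField.subset_adjoin k S hv⟩ : IntermediateField.adjoin k S)⟩

theorem aeval_lineSubst {B : Type*} [CommRing B] [Algebra k B] [Algebra B L] [IsScalarTower k B L]
    (b : ι → B) (a : ι → k) (w : L) (f : MvPolynomial ι k) :
    Polynomial.aeval w (lineSubst b a f) = aeval (fun j ↦ algebraMap B L (b j) + a j • w) f := by
  induction f using MvPolynomial.induction_on with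
  | C c =>
    simp [lineSubst, Polynomial.algebraMap_apply, ← IsScalarTower.algebraMap_apply]
  | add p q hp hq => simp only [map_add, hp, hq]
  | mul_X p i hp =>
    rw [map_mul, map_mul, hp, map_mul]
    simp [lineSubst, ← IsScalarTower.algebraMap_apply, Algebra.smul_def]

/-- The elimination step of Noether normalization, keeping track of separability: linearly
combining algebraically dependent elements, one of them can be removed. -/
theorem exists_elimination [Infinite k] [PerfectField k] [Fintype ι] {l : ι → L}
    (hl : ¬ AlgebraicIndependent k l) :
    ∃ W : Submodule k L, W ≤ Submodule.span k (Set.range l) ∧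
      Module.finrank k W < Fintype.card ι ∧
      IsIntegralSeparableOver k (W : Set L) (Set.range l) := by
  classical
  obtain ⟨f, ⟨hf0, hfl⟩, hmin⟩ : ∃ f : MvPolynomial ι k, (f ≠ 0 ∧ aeval l f = 0) ∧
      ∀ g : MvPolynomial ι k, g ≠ 0 → aeval l g = 0 → f.totalDegree ≤ g.totalDegree := by
    rw [AlgebraicIndependent, injective_iff_map_eq_zero] at hl
    push Not at hl
    obtain ⟨f, h1, h2⟩ := hl
    obtain ⟨m, hm, hm'⟩ := (measure (fun g : MvPolynomial ι k ↦ g.totalDegree)).wf.has_min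
      {f | f ≠ 0 ∧ aeval l f = 0} ⟨f, h2, h1⟩
    exact ⟨m, hm, fun g hg0 hg ↦ not_lt.mp (hm' g ⟨hg0, hg⟩)⟩
  obtain ⟨i, hi⟩ := exists_aeval_pderiv_ne_zero hmin hf0 hfl
  set e := f.totalDegree with he
  have htop : homogeneousComponent e f ≠ 0 := by
    obtain ⟨s, hs, hse⟩ := Finset.exists_mem_eq_sup f.support (support_nonempty.mpr hf0)
      (fun s ↦ Finsupp.degree s)
    intro h0
    have := congrArg (coeff s) h0
    rw [coeff_homogeneousComponent, if_pos, coeff_zero] at this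
    · exact mem_support_iff.mp hs this
    · rw [← hse, he]; rfl
  -- The condition $\sum_j a_j\,\partial_jf(l)\ne0$ takes place in $L$; applying $\varphi$ makes it
  -- the nonvanishing at $a$ of a linear form $q$ over $k$.
  obtain ⟨φ, hφ⟩ : ∃ φ : Module.Dual k L, φ (aeval l (pderiv i f)) ≠ 0 := by
    by_contra! h
    exact hi ((Module.forall_dual_apply_eq_zero_iff k _).mp h)
  set q : MvPolynomial ι k := ∑ j, C (φ (aeval l (pderiv j f))) * X j with hq
  have hq0 : q ≠ 0 := by
    intro h0
    have := congrArg (coeff (Finsupp.single i 1)) h0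
    rw [hq, coeff_sum, Finset.sum_eq_single i] at this
    · simp at this; exact hφ this
    · intro j _ hj
      simp [coeff_C_mul, coeff_X, Finsupp.single_left_inj, hj]
    · simp
  -- Over the infinite field $k$ one direction $a$ serves both purposes: the top form gives
  -- integrality, $q$ gives separability.
  obtain ⟨a, ha⟩ : ∃ a : ι → k, eval a (homogeneousComponent e f * q) ≠ 0 := by
    by_contra! h
    exact mul_ne_zero htop hq0 (MvPolynomial.funext fun x ↦ by rw [h, map_zero])
  rw [map_mul] at ha
  have ha1 := left_ne_zero_of_mul ha
  have ha2 : ∑ j, a j • aeval l (pderiv j f) ≠ 0 := by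
    intro h0
    apply right_ne_zero_of_mul ha
    have := congrArg φ h0
    rw [map_sum, map_zero] at this
    rw [hq, map_sum, ← this]
    exact Finset.sum_congr rfl fun j _ ↦ by simp [mul_comm]
  obtain ⟨i₀, hi₀⟩ : ∃ i₀, a i₀ ≠ 0 := by
    by_contra! h
    simp [h] at ha2
  -- Scaled so that $l'_{i_0}=0$: one generator disappears.
  set w : L := (a i₀)⁻¹ • l i₀ with hw
  set l' : ι → L := fun j ↦ l j - a j • w with hl'
  have hl'0 : l' i₀ = 0 := by
    simp [hl', hw, smul_smul, mul_inv_cancel₀ hi₀]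
  set W : Submodule k L := Submodule.span k (Set.range fun j : {j // j ≠ i₀} ↦ l' j) with hW
  have hl'W : ∀ j, l' j ∈ W := by
    intro j
    by_cases hj : j = i₀
    · rw [hj, hl'0]; exact W.zero_mem
    · exact Submodule.subset_span ⟨⟨j, hj⟩, rfl⟩
  have hll' : ∀ j, l j = l' j + a j • w := fun j ↦ by simp [hl']
  have hWI : W ≤ Submodule.span k (Set.range l) := by
    rw [hW, Submodule.span_le]
    rintro _ ⟨j, rfl⟩
    exact Submodule.sub_mem _ (Submodule.subset_span ⟨_, rfl⟩)
      (Submodule.smul_mem _ _ (Submodule.smul_mem _ _ (Submodule.subset_span ⟨_, rfl⟩)))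
  refine ⟨W, hWI, ?_, ?_⟩
  · refine (finrank_range_le_card _).trans_lt ?_
    exact Fintype.card_subtype_lt (x := i₀) (by simp)
  · have hA : ∀ j, l' j ∈ Algebra.adjoin k (W : Set L) := fun j ↦ Algebra.subset_adjoin (hl'W j)
    have hK : ∀ j, l' j ∈ IntermediateField.adjoin k (W : Set L) :=
      fun j ↦ IntermediateField.subset_adjoin k _ (hl'W j)
    have hwint : IsIntegral (Algebra.adjoin k (W : Set L)) w := by
      let b : ι → Algebra.adjoin k (W : Set L) := fun j ↦ ⟨l' j, hA j⟩
      obtain ⟨h1, h2⟩ := coeff_lineSubst b a f he.ge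
      refine isIntegral_of_isUnit_coeff h1
        (u := algebraMap k _ (eval a (homogeneousComponent e f))⁻¹) ?_ ?_
      · rw [h2, ← map_mul, inv_mul_cancel₀ ha1, map_one]
      · rw [aeval_lineSubst, ← hfl]
        congr 2
        ext j
        rw [hll' j]
        rfl
    have hwsep : IsSeparable (IntermediateField.adjoin k (W : Set L)) w := by
      let b : ι → IntermediateField.adjoin k (W : Set L) := fun j ↦ ⟨l' j, hK j⟩
      have hb : (fun j ↦ algebraMap (IntermediateField.adjoin k (W : Set L)) L (b j) + a j • w)
          = l := by
        ext j
        rw [hll' j]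
        rfl
      refine isSeparable_of_aeval_derivative_ne_zero (g := lineSubst b a f) ?_ ?_
      · rw [aeval_lineSubst, hb, hfl]
      · rw [derivative_lineSubst, map_sum]
        convert ha2 using 2 with j
        rw [map_mul, aeval_lineSubst, hb, Algebra.smul_def, Polynomial.aeval_C,
          ← IsScalarTower.algebraMap_apply]
    have hwW : IsIntegralSeparableOver k (W : Set L) (insert w (W : Set L)) := by
      have := isIntegralSeparableOver_self (k := k) (W : Set L)
      refine ⟨?_, ?_⟩
      · rintro v (rfl | hv)
        exacts [hwint, this.1 v hv]
      · rintro v (rfl | hv)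
        exacts [hwsep, this.2 v hv]
    have hsub : Set.range l ⊆ (Submodule.span k (insert w (W : Set L)) : Set L) := by
      rintro _ ⟨j, rfl⟩
      rw [hll' j]
      exact Submodule.add_mem _ (Submodule.subset_span (Or.inr (hl'W j)))
        (Submodule.smul_mem _ _ (Submodule.subset_span (Or.inl rfl)))
    exact ⟨fun v hv ↦ hwW.span.1 v (hsub hv), fun v hv ↦ hwW.span.2 v (hsub hv)⟩

/-- Noether normalization by linear combinations of the generators, with a separable extension
of function fields. -/
theorem exists_algebraicIndependent_isIntegralSeparableOver [Infinite k] [PerfectField k]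
    (V : Submodule k L) [FiniteDimensional k V] :
    ∃ (s : ℕ) (l : Fin s → L), (∀ i, l i ∈ V) ∧ AlgebraicIndependent k l ∧
      IsIntegralSeparableOver k (Set.range l) (V : Set L) := by
  -- A basis of a subspace $W$ of least dimension is algebraically independent, since otherwise
  -- `exists_elimination` would shrink $W$.
  obtain ⟨W, ⟨hWV, hW⟩, hmin⟩ := (measure (fun W : Submodule k L ↦ Module.finrank k W)).wf.has_min
    {W | W ≤ V ∧ IsIntegralSeparableOver k (W : Set L) (V : Set L)}
    ⟨V, le_rfl, isIntegralSeparableOver_self _⟩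
  have : FiniteDimensional k W := Submodule.finiteDimensional_of_le hWV
  let b := Module.finBasis k W
  have hspan : Submodule.span k (Set.range fun i ↦ (b i : L)) = W := by
    have := b.span_eq
    have h2 := congrArg (Submodule.map W.subtype) this
    rwa [Submodule.map_span, Submodule.map_top, Submodule.range_subtype, ← Set.range_comp] at h2
  refine ⟨_, fun i ↦ (b i : L), fun i ↦ hWV (b i).2, ?_, ?_⟩
  · by_contra h
    obtain ⟨W', hW', hlt, hint⟩ := exists_elimination h
    rw [hspan] at hW'
    have h3 := hint.span
    rw [hspan] at h3
    refine hmin W' ⟨hW'.trans hWV, h3.trans hW⟩ ?_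
    change Module.finrank k W' < Module.finrank k W
    simpa using hlt
  · have := (isIntegralSeparableOver_self (k := k) (Set.range fun i ↦ (b i : L))).span
    rw [hspan] at this
    exact this.trans hW

end NoetherNormalization

/-! ### Krull dimension of integral extensions. -/

section KrullDim

/-- Incomparability makes contraction strictly monotone; lying over and going up lift chains of
primes. -/
theorem ringKrullDim_eq_of_isIntegral {A B : Type*} [CommRing A] [CommRing B] [Algebra A B]
    [Algebra.IsIntegral A B] (hinj : Function.Injective (algebraMap A B)) :
    ringKrullDim B = ringKrullDim A := by
  apply le_antisymm
  · refine Order.krullDim_le_of_strictMono (PrimeSpectrum.comap (algebraMap A B)) ?_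
    intro P Q hPQ
    exact Ideal.IsIntegral.comap_lt_comap (R := A) hPQ
  · have key : ∀ p : LTSeries (PrimeSpectrum A), ∃ q : LTSeries (PrimeSpectrum B),
        q.length = p.length ∧ PrimeSpectrum.comap (algebraMap A B) q.last = p.last := by
      intro p
      induction p using RelSeries.inductionOn' with
      | singleton P =>
        obtain ⟨Q, -, hQ, hQP⟩ := Ideal.exists_ideal_over_prime_of_isIntegral P.asIdeal
          (⊥ : Ideal B) (by
            rw [← RingHom.ker_eq_comap_bot, (RingHom.injective_iff_ker_eq_bot _).mp hinj]
            exact bot_le)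
        exact ⟨RelSeries.singleton _ ⟨Q, hQ⟩, rfl, PrimeSpectrum.ext hQP⟩
      | snoc p P hP ih =>
        obtain ⟨q, hq, hql⟩ := ih
        have hle : q.last.asIdeal.comap (algebraMap A B) ≤ P.asIdeal := by
          have : (PrimeSpectrum.comap (algebraMap A B) q.last).asIdeal ≤ P.asIdeal := by
            rw [hql]; exact (show p.last < P from hP).le
          exact this
        obtain ⟨Q, hQ, hQp, hQP⟩ := Ideal.exists_ideal_over_prime_of_isIntegral P.asIdeal
          q.last.asIdeal hle
        have hcomap : PrimeSpectrum.comap (algebraMap A B) ⟨Q, hQp⟩ = P := PrimeSpectrum.ext hQP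
        have hlt : q.last < ⟨Q, hQp⟩ := by
          refine lt_of_le_of_ne hQ fun h ↦ ?_
          rw [← h, hql] at hcomap
          exact (show p.last < P from hP).ne hcomap
        refine ⟨q.snoc ⟨Q, hQp⟩ hlt, ?_, ?_⟩
        · simp [hq]
        · simpa using hcomap
    refine iSup_le fun p ↦ ?_
    obtain ⟨q, hq, -⟩ := key p
    rw [← hq]
    exact le_iSup (fun q : LTSeries (PrimeSpectrum B) ↦ ((q.length : ℕ∞) : WithBot ℕ∞)) q

end KrullDim

/-! ### Values of forms and homogeneity of minimal polynomials. -/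

section Forms

variable {k L ι κ : Type*} [Field k] [Field L] [Algebra k L]

/-- The space of values at `x` of the forms of degree `m`. -/
noncomputable def formsAt (x : ι → L) (m : ℕ) : Submodule k L :=
  (homogeneousSubmodule ι k m).map (aeval x).toLinearMap

theorem mem_formsAt {x : ι → L} {m : ℕ} {y : L} :
    y ∈ formsAt (k := k) x m ↔ ∃ f : MvPolynomial ι k, f.IsHomogeneous m ∧ aeval x f = y := Iff.rfl

theorem mul_mem_formsAt {x : ι → L} {a b : ℕ} {y z : L} (hy : y ∈ formsAt (k := k) x a)
    (hz : z ∈ formsAt (k := k) x b) : y * z ∈ formsAt (k := k) x (a + b) := by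
  obtain ⟨f, hf, rfl⟩ := hy
  obtain ⟨g, hg, rfl⟩ := hz
  exact ⟨f * g, hf.mul hg, by simp⟩

theorem pow_mem_formsAt {x : ι → L} {a : ℕ} {y : L} (hy : y ∈ formsAt (k := k) x a) (i : ℕ) :
    y ^ i ∈ formsAt (k := k) x (a * i) := by
  obtain ⟨f, hf, rfl⟩ := hy
  exact ⟨f ^ i, hf.pow i, by simp⟩

theorem span_range_le_formsAt_one (x : ι → L) :
    Submodule.span k (Set.range x) ≤ formsAt (k := k) x 1 := by
  rw [Submodule.span_le]
  rintro _ ⟨i, rfl⟩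
  exact ⟨X i, isHomogeneous_X k i, by simp⟩

theorem formsAt_le_formsAt {x : ι → L} {l : κ → L} (h : ∀ i, l i ∈ formsAt (k := k) x 1) (m : ℕ) :
    formsAt (k := k) l m ≤ formsAt (k := k) x m := by
  choose p hp hpl using fun i ↦ mem_formsAt.mp (h i)
  rintro _ ⟨f, hf, rfl⟩
  refine ⟨aeval p f, ?_, ?_⟩
  · simpa using IsHomogeneous.aeval hf p hp
  · change aeval x (aeval p f) = aeval l f
    rw [← AlgHom.comp_apply, comp_aeval]
    congr 2
    ext i
    exact hpl i

instance [Finite ι] (x : ι → L) (m : ℕ) : FiniteDimensional k (formsAt (k := k) x m) := by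
  unfold formsAt; infer_instance

theorem finrank_formsAt_le {d : ℕ} (l : Fin (d + 1) → L) (m : ℕ) :
    Module.finrank k (formsAt (k := k) l m) ≤ (m + d).choose d := by
  rw [← finrank_homogeneousSubmodule (k := k)]
  exact Submodule.finrank_map_le _ _

theorem finrank_formsAt_of_algebraicIndependent {d : ℕ} {l : Fin (d + 1) → L}
    (hl : AlgebraicIndependent k l) (m : ℕ) :
    Module.finrank k (formsAt (k := k) l m) = (m + d).choose d := by
  rw [← finrank_homogeneousSubmodule (k := k)]
  exact (Submodule.equivMapOfInjective (aeval l).toLinearMap hl _).finrank_eq.symm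

theorem homogeneousComponent_aeval {p : κ → MvPolynomial ι k} (hp : ∀ i, (p i).IsHomogeneous 1)
    (f : MvPolynomial κ k) (m : ℕ) :
    homogeneousComponent m (aeval p f) = aeval p (homogeneousComponent m f) := by
  conv_lhs => rw [← sum_homogeneousComponent f]
  rw [map_sum, map_sum]
  have h : ∀ i, (aeval p (homogeneousComponent i f)).IsHomogeneous i := fun i ↦ by
    simpa using IsHomogeneous.aeval (homogeneousComponent_isHomogeneous i f) p hp
  rw [Finset.sum_congr rfl fun i _ ↦ homogeneousComponent_of_mem (h i)]
  rw [Finset.sum_ite_eq]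
  split_ifs with hm
  · rfl
  · rw [homogeneousComponent_eq_zero, map_zero]
    simpa using hm

/-- Lift the minimal equation of $y$ to a polynomial relation at $x$ and keep its component of
degree $mN$. The kernel at $x$ is homogeneous, so this is again a monic equation of degree $N$ for
$y$; by uniqueness it is the minimal one, and its coefficients are forms in $l$. -/
theorem minpoly_coeff_mem_formsAt {x : ι → L} {l : κ → L} {K : IntermediateField k L}
    (hx : ∀ f : MvPolynomial ι k, aeval x f = 0 → ∀ m, aeval x (homogeneousComponent m f) = 0)
    (hl : ∀ i, l i ∈ formsAt (k := k) x 1) (hlK : ∀ i, l i ∈ K)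
    {m : ℕ} {y : L} (hy : y ∈ formsAt (k := k) x m)
    (hint : ∀ j, ((minpoly K y).coeff j : L) ∈ Algebra.adjoin k (Set.range l))
    (hyK : IsIntegral K y) (j : ℕ) (hj : j < (minpoly K y).natDegree) :
    ((minpoly K y).coeff j : L) ∈ formsAt (k := k) l (((minpoly K y).natDegree - j) * m) := by
  set N := (minpoly K y).natDegree with hN
  obtain ⟨σ, hσ, rfl⟩ := mem_formsAt.mp hy
  choose p hp hpl using fun i ↦ mem_formsAt.mp (hl i)
  have hαex : ∀ j, ∃ α : MvPolynomial κ k, aeval l α = ((minpoly K (aeval x σ)).coeff j : L) := by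
    intro j
    have := hint j
    rwa [Algebra.adjoin_range_eq_range_aeval] at this
  choose α hα using hαex
  have hpx : ∀ g : MvPolynomial κ k, aeval x (aeval p g) = aeval l g := by
    intro g
    rw [← AlgHom.comp_apply, comp_aeval]
    congr 2
    ext i
    exact hpl i
  have hlK' : ∀ g : MvPolynomial κ k, aeval l g ∈ K := by
    intro g
    have h : aeval l g = (aeval (fun i ↦ (⟨l i, hlK i⟩ : K)) g : K) := by
      rw [← IntermediateField.coe_val, ← AlgHom.comp_apply, comp_aeval]
      rfl
    rw [h]
    exact SetLike.coe_mem _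
  let β : ℕ → MvPolynomial κ k := fun j ↦ homogeneousComponent ((N - j) * m) (α j)
  let F : MvPolynomial ι k := σ ^ N + ∑ j ∈ Finset.range N, σ ^ j * aeval p (α j)
  have hmonic := minpoly.monic hyK
  have hF : aeval x F = 0 := by
    have h := minpoly.aeval K (aeval x σ)
    rw [Polynomial.aeval_eq_sum_range, Finset.sum_range_succ, ← hN] at h
    rw [hN, hmonic.coeff_natDegree, one_smul, ← hN] at h
    rw [← h, add_comm]
    simp only [F, map_add, map_sum, map_mul, map_pow, hpx, hα]
    congr 1
    exact Finset.sum_congr rfl fun j _ ↦ by rw [mul_comm]; rfl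
  have hG : aeval x (σ ^ N + ∑ j ∈ Finset.range N, σ ^ j * aeval p (β j)) = 0 := by
    have h := hx F hF (m * N)
    rw [map_add, homogeneousComponent_eq_self (hσ.pow N), map_sum] at h
    rw [← h]
    congr 2
    refine Finset.sum_congr rfl fun j hj ↦ ?_
    have hj' : j < N := Finset.mem_range.mp hj
    rw [show m * N = m * j + (N - j) * m by
      rw [mul_comm (N - j), ← mul_add]; congr 1; omega,
      homogeneousComponent_mul_of_isHomogeneous (hσ.pow j), homogeneousComponent_aeval hp]
  let S : Polynomial K := ∑ j ∈ Finset.range N,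
    Polynomial.C (⟨aeval l (β j), hlK' _⟩ : K) * Polynomial.X ^ j
  have hSdeg : S.degree < N := by
    refine Polynomial.mem_degreeLT.mp (Submodule.sum_mem _ fun j hj ↦ Polynomial.mem_degreeLT.mpr ?_)
    exact (Polynomial.degree_C_mul_X_pow_le _ _).trans_lt
      (by exact_mod_cast Finset.mem_range.mp hj)
  let P : Polynomial K := Polynomial.X ^ N + S
  have hPmonic : P.Monic := Polynomial.monic_X_pow_add hSdeg
  have hPdeg : P.natDegree = N := by
    have := Polynomial.degree_add_eq_left_of_degree_lt
      (p := (Polynomial.X ^ N : Polynomial K)) (q := S) (by rwa [Polynomial.degree_X_pow])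
    rw [Polynomial.degree_X_pow] at this
    exact Polynomial.natDegree_eq_of_degree_eq_some this
  have hProot : Polynomial.aeval (aeval x σ) P = 0 := by
    rw [← hG]
    simp only [P, S, map_add, map_sum, map_mul, map_pow, hpx, Polynomial.aeval_X,
      Polynomial.aeval_C]
    congr 1
    exact Finset.sum_congr rfl fun j _ ↦ by rw [mul_comm]; rfl
  have heq : P = minpoly K (aeval x σ) := by
    refine Polynomial.eq_of_dvd_of_natDegree_le_of_leadingCoeff (minpoly.dvd K _ hProot) ?_ ?_ |>.symm
    · rw [hPdeg]
    · rw [hPmonic.leadingCoeff, hmonic.leadingCoeff]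
  have hcoeff : P.coeff j = ⟨aeval l (β j), hlK' _⟩ := by
    simp only [P, S, Polynomial.coeff_add, Polynomial.coeff_X_pow, Polynomial.finsetSum_coeff,
      Polynomial.coeff_C_mul]
    rw [if_neg hj.ne, zero_add, Finset.sum_eq_single j]
    · simp
    · intro i _ hi
      simp [hi.symm]
    · intro h
      exact absurd (Finset.mem_range.mpr hj) h
  rw [← heq, hcoeff]
  exact ⟨β j, homogeneousComponent_isHomogeneous _ _, rfl⟩

end Forms

open scoped IntermediateField IntermediateField.algebraAdjoinAdjoin

/-! ### Primitive elements in a generating subspace. -/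

section PrimitiveElement

variable {k L : Type*} [Field k] [Field L] [Algebra k L]

/-- There are finitely many intermediate fields, and a vector space over an infinite field is not a
finite union of proper subspaces. -/
theorem exists_mem_adjoin_simple_eq_top [Infinite k] (K : IntermediateField k L)
    [FiniteDimensional K L] [Algebra.IsSeparable K L] (V : Submodule k L)
    (hV : IntermediateField.adjoin K (V : Set L) = ⊤) : ∃ u ∈ V, K⟮u⟯ = ⊤ := by
  have : Finite (IntermediateField K L) :=
    (Field.exists_primitive_element_iff_finite_intermediateField K L).mp
      ⟨inferInstance, Field.exists_primitive_element K L⟩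
  by_contra! h
  let p : {E : IntermediateField K L // E ≠ ⊤} → Subspace k V := fun E ↦
    Submodule.comap V.subtype ((Subalgebra.toSubmodule E.1.toSubalgebra).restrictScalars k)
  have hcover : ⋃ E, (p E : Set V) = Set.univ := by
    rw [Set.eq_univ_iff_forall]
    intro u
    exact Set.mem_iUnion.mpr ⟨⟨K⟮(u : L)⟯, h u u.2⟩, IntermediateField.mem_adjoin_simple_self K _⟩
  obtain ⟨E, hE⟩ := Subspace.exists_eq_top_of_iUnion_eq_univ hcover
  apply E.2
  refine eq_top_iff.mpr (hV.ge.trans ?_)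
  rw [IntermediateField.adjoin_le_iff]
  intro v hv
  have : (⟨v, hv⟩ : V) ∈ p E := by rw [hE]; trivial
  exact this

end PrimitiveElement

/-! ### Two-sided bounds for prime ideals. -/

section Bounds

variable {k L : Type*} [Field k] [Field L] [Algebra k L] {n d : ℕ}

theorem isIntegral_of_mem_formsAt {ι κ : Type*} {x : ι → L} {l : κ → L}
    (hint : ∀ i, IsIntegral (Algebra.adjoin k (Set.range l)) (x i)) (f : MvPolynomial ι k) :
    IsIntegral (Algebra.adjoin k (Set.range l)) (aeval x f) := by
  have h : Algebra.adjoin k (Set.range x) ≤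
      (integralClosure (Algebra.adjoin k (Set.range l)) L).restrictScalars k := by
    rw [Algebra.adjoin_le_iff]
    rintro _ ⟨i, rfl⟩
    exact hint i
  refine h ?_
  rw [Algebra.adjoin_range_eq_range_aeval]
  exact ⟨f, rfl⟩

/-- The trace is an integer multiple of the coefficient of $T^{N-1}$ in the minimal polynomial, the
case $j=N-1$ of `minpoly_coeff_mem_formsAt`. The coefficients lie in $k[l]$ because this polynomial
ring is integrally closed. -/
theorem trace_mem_formsAt {ι κ : Type*} {x : ι → L} {l : κ → L}
    (hx : ∀ f : MvPolynomial ι k, aeval x f = 0 → ∀ m, aeval x (homogeneousComponent m f) = 0)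
    (hlx : ∀ i, l i ∈ formsAt (k := k) x 1) (hl : AlgebraicIndependent k l)
    (hint : ∀ i, IsIntegral (Algebra.adjoin k (Set.range l)) (x i))
    [FiniteDimensional (IntermediateField.adjoin k (Set.range l)) L]
    {m : ℕ} {y : L} (hy : y ∈ formsAt (k := k) x m) :
    (Algebra.trace (IntermediateField.adjoin k (Set.range l)) L y : L) ∈
      formsAt (k := k) l m := by
  have : IsIntegrallyClosed (Algebra.adjoin k (Set.range l)) :=
    IsIntegrallyClosed.of_equiv hl.aevalEquiv.toRingEquiv
  have hyA : IsIntegral (Algebra.adjoin k (Set.range l)) y := by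
    obtain ⟨f, -, rfl⟩ := hy
    exact isIntegral_of_mem_formsAt hint f
  have hyK : IsIntegral (IntermediateField.adjoin k (Set.range l)) y := .of_finite _ _
  have hpos := minpoly.natDegree_pos hyK
  set K := IntermediateField.adjoin k (Set.range l) with hK
  have key := minpoly_coeff_mem_formsAt (K := K) hx hlx (fun i ↦ IntermediateField.subset_adjoin k _ (Set.mem_range_self i))
    hy (fun j ↦ by
      rw [minpoly.isIntegrallyClosed_eq_field_fractions' _ hyA, Polynomial.coeff_map]
      exact SetLike.coe_mem _) hyK ((minpoly K y).natDegree - 1) (by omega)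
  rw [show ∀ N, 0 < N → (N - (N - 1)) * m = m by
    intro N hN; rw [show N - (N - 1) = 1 by omega, one_mul]] at key
  · rw [trace_eq_finrank_mul_minpoly_nextCoeff, Polynomial.nextCoeff_of_natDegree_pos hpos]
    push_cast
    rw [← nsmul_eq_mul]
    exact Submodule.smul_of_tower_mem _ _ (Submodule.neg_mem _ key)
  · exact hpos

theorem finrank_formsAt_le_sum {x : Fin (n + 1) → L} {l : Fin (d + 1) → L}
    (hx : ∀ f : MvPolynomial (Fin (n + 1)) k,
      aeval x f = 0 → ∀ m, aeval x (homogeneousComponent m f) = 0)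
    (hlx : ∀ i, l i ∈ formsAt (k := k) x 1) (hl : AlgebraicIndependent k l)
    (hint : ∀ i, IsIntegral (Algebra.adjoin k (Set.range l)) (x i))
    [FiniteDimensional (IntermediateField.adjoin k (Set.range l)) L]
    [Algebra.IsSeparable (IntermediateField.adjoin k (Set.range l)) L]
    {u : L} (hu : u ∈ formsAt (k := k) x 1)
    (hutop : (IntermediateField.adjoin k (Set.range l))⟮u⟯ = ⊤) (m : ℕ) :
    Module.finrank k (formsAt (k := k) x m) ≤
      ∑ i ∈ Finset.range (Module.finrank (IntermediateField.adjoin k (Set.range l)) L),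
        (m + i + d).choose d := by
  set K := IntermediateField.adjoin k (Set.range l) with hK
  have hr := (Field.primitive_element_iff_minpoly_natDegree_eq K u).mp hutop
  let T : ∀ i : Fin (minpoly K u).natDegree,
      formsAt (k := k) x m →ₗ[k] formsAt (k := k) l (m + i) := fun i ↦
    (K.val.toLinearMap ∘ₗ ((Algebra.trace K L).restrictScalars k) ∘ₗ
      (LinearMap.mulRight k (u ^ (i : ℕ))) ∘ₗ (formsAt (k := k) x m).subtype).codRestrict _ (by
        rintro ⟨y, hy⟩
        refine trace_mem_formsAt hx hlx hl hint (mul_mem_formsAt hy ?_)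
        simpa using pow_mem_formsAt hu i)
  have hT : ∀ i y, (T i y : L) = Algebra.trace K L (y * u ^ (i : ℕ)) := fun _ _ ↦ rfl
  have hinj : Function.Injective (LinearMap.pi T) := by
    rw [injective_iff_map_eq_zero]
    intro y hy
    have hspan : ⊤ ≤ Submodule.span K (Set.range fun i : Fin (minpoly K u).natDegree ↦
        u ^ (i : ℕ)) :=
      ((linearIndependent_pow u).span_eq_top_of_card_eq_finrank' (by simpa using hr)).ge
    have hzero : ∀ z : L, Algebra.trace K L (y * z) = 0 := by
      intro z
      have : Submodule.span K (Set.range fun i : Fin (minpoly K u).natDegree ↦ u ^ (i : ℕ)) ≤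
          LinearMap.ker (Algebra.traceForm K L (y : L)) := by
        rw [Submodule.span_le]
        rintro _ ⟨i, rfl⟩
        have := congrArg (Subtype.val) (congrFun hy i)
        rw [LinearMap.pi_apply, hT] at this
        exact Subtype.val_injective this
      exact this (hspan (Submodule.mem_top (x := z)))
    exact Subtype.ext ((traceForm_nondegenerate K L).1 _ hzero)
  have h := LinearMap.finrank_le_finrank_of_injective hinj
  rw [Module.finrank_pi_fintype] at h
  refine h.trans ?_
  rw [← hr, ← Fin.sum_univ_eq_sum_range (fun i ↦ (m + i + d).choose d)]
  exact Finset.sum_le_sum fun i _ ↦ finrank_formsAt_le l _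

theorem finrank_mul_choose_le_finrank_formsAt {x : Fin (n + 1) → L} {l : Fin (d + 1) → L}
    (hlx : ∀ i, l i ∈ formsAt (k := k) x 1) (hl : AlgebraicIndependent k l)
    [FiniteDimensional (IntermediateField.adjoin k (Set.range l)) L]
    {u : L} (hu : u ∈ formsAt (k := k) x 1)
    (hutop : (IntermediateField.adjoin k (Set.range l))⟮u⟯ = ⊤) (m : ℕ) :
    Module.finrank (IntermediateField.adjoin k (Set.range l)) L * (m + d).choose d ≤
      Module.finrank k (formsAt (k := k) x
        (m + Module.finrank (IntermediateField.adjoin k (Set.range l)) L)) := by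
  set K := IntermediateField.adjoin k (Set.range l) with hK
  have hr := (Field.primitive_element_iff_minpoly_natDegree_eq K u).mp hutop
  rw [← hr]
  set r := (minpoly K u).natDegree
  let T : (∀ i : Fin r, formsAt (k := k) l (m + (r - i))) →ₗ[k] formsAt (k := k) x (m + r) :=
    (∑ i : Fin r, LinearMap.mulRight k (u ^ (i : ℕ)) ∘ₗ (formsAt (k := k) l _).subtype ∘ₗ
      LinearMap.proj i).codRestrict _ (by
        intro c
        rw [LinearMap.sum_apply]
        refine Submodule.sum_mem _ fun i _ ↦ ?_
        have h1 := formsAt_le_formsAt hlx _ (c i).2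
        have h2 := mul_mem_formsAt h1 (pow_mem_formsAt hu i)
        rw [one_mul, add_assoc, Nat.sub_add_cancel i.2.le] at h2
        exact h2)
  have hT : ∀ c, (T c : L) = ∑ i : Fin r, (c i : L) * u ^ (i : ℕ) := by
    intro c
    simp [T]
  have hlK : ∀ (j : ℕ) (y : formsAt (k := k) l j), (y : L) ∈ K := by
    rintro j ⟨_, f, -, rfl⟩
    refine IntermediateField.algebra_adjoin_le_adjoin k (Set.range l) ?_
    rw [Algebra.adjoin_range_eq_range_aeval]
    exact ⟨f, rfl⟩
  have hinj : Function.Injective T := by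
    rw [injective_iff_map_eq_zero]
    intro c hc
    have h0 : ∑ i : Fin r, (⟨(c i : L), hlK _ _⟩ : K) • u ^ (i : ℕ) = 0 := by
      rw [← ZeroMemClass.coe_zero (formsAt (k := k) x (m + r)), ← hc, hT]
      rfl
    have h1 := Fintype.linearIndependent_iff.mp (linearIndependent_pow (K := K) u) _ h0
    ext i
    exact congrArg (fun z : K ↦ (z : L)) (h1 i)
  have h := LinearMap.finrank_le_finrank_of_injective hinj
  rw [Module.finrank_pi_fintype] at h
  refine le_trans ?_ h
  simp_rw [finrank_formsAt_of_algebraicIndependent hl]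
  -- Each summand lives in degree $m+r-i\ge m$; this loss does not affect leading coefficients.
  refine (le_of_eq ?_).trans (Finset.card_nsmul_le_sum _ _ ((m + d).choose d) fun i _ ↦ ?_)
  · simp
  · exact Nat.choose_le_choose d (by omega)

end Bounds

section Prime

variable {k : Type*} [Field k] {n d : ℕ}

theorem exists_bounds_of_adjoin_eq_top {L : Type*} [Field L] [Algebra k L] [Infinite k]
    [PerfectField k] (x : Fin (n + 1) → L)
    (htop : IntermediateField.adjoin k (Set.range x) = ⊤)
    (hx : ∀ f : MvPolynomial (Fin (n + 1)) k,
      aeval x f = 0 → ∀ m, aeval x (homogeneousComponent m f) = 0)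
    (hd : ringKrullDim (aeval (R := k) x).range = d + 1) :
    ∃ r : ℕ, ∀ m,
      Module.finrank k (formsAt (k := k) x m) ≤ ∑ i ∈ Finset.range r, (m + i + d).choose d ∧
      r * (m + d).choose d ≤ Module.finrank k (formsAt (k := k) x (m + r)) := by
  set V := Submodule.span k (Set.range x) with hV
  have : FiniteDimensional k V := FiniteDimensional.span_of_finite k (Set.finite_range x)
  obtain ⟨s, l, hlV, hl, hli, hls⟩ := exists_algebraicIndependent_isIntegralSeparableOver V
  have hxV : ∀ i, x i ∈ V := fun i ↦ Submodule.subset_span ⟨i, rfl⟩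
  have hlx : ∀ i, l i ∈ formsAt (k := k) x 1 := fun i ↦ span_range_le_formsAt_one x (hlV i)
  have hint : ∀ i, IsIntegral (Algebra.adjoin k (Set.range l)) (x i) := fun i ↦ hli _ (hxV i)
  -- Both $k[l]$, a polynomial ring in $s$ variables, and its integral extension $k[x]$ have the
  -- same dimension.
  obtain rfl : s = d + 1 := by
    have hle : Algebra.adjoin k (Set.range l) ≤ (aeval (R := k) x).range := by
      rw [Algebra.adjoin_le_iff]
      rintro _ ⟨i, rfl⟩
      obtain ⟨f, -, hf⟩ := hlx i
      exact ⟨f, hf⟩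
    let _ : Algebra (Algebra.adjoin k (Set.range l)) (aeval (R := k) x).range :=
      (Subalgebra.inclusion hle).toAlgebra
    have : IsScalarTower (Algebra.adjoin k (Set.range l)) (aeval (R := k) x).range L :=
      .of_algebraMap_eq fun _ ↦ rfl
    have : Algebra.IsIntegral (Algebra.adjoin k (Set.range l)) (aeval (R := k) x).range := by
      refine ⟨fun y ↦ ?_⟩
      rw [← isIntegral_algebraMap_iff (B := L) Subtype.val_injective]
      obtain ⟨_, f, rfl⟩ := y
      exact isIntegral_of_mem_formsAt hint f
    have h1 := ringKrullDim_eq_of_isIntegral (A := Algebra.adjoin k (Set.range l))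
      (B := (aeval (R := k) x).range) (Subalgebra.inclusion_injective hle)
    rw [hd, ← ringKrullDim_eq_of_ringEquiv hl.aevalEquiv.toRingEquiv,
      MvPolynomial.ringKrullDim_of_isNoetherianRing, ringKrullDim_eq_zero_of_field, zero_add,
      Nat.card_fin] at h1
    exact_mod_cast h1.symm
  set K := IntermediateField.adjoin k (Set.range l) with hK
  have htopK : IntermediateField.adjoin K (Set.range x) = ⊤ := by
    rw [eq_top_iff]
    intro y _
    have : IntermediateField.adjoin k (Set.range x) ≤
        (IntermediateField.adjoin K (Set.range x)).restrictScalars k := by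
      rw [IntermediateField.adjoin_le_iff]
      exact IntermediateField.subset_adjoin K _
    rw [htop] at this
    exact this (IntermediateField.mem_top (x := y))
  have hfin : FiniteDimensional K L := by
    have : FiniteDimensional K (IntermediateField.adjoin K (Set.range x)) := by
      refine IntermediateField.finiteDimensional_adjoin ?_
      rintro _ ⟨i, rfl⟩
      exact (hls _ (hxV i)).isIntegral
    rw [htopK] at this
    exact (IntermediateField.topEquiv (F := K) (E := L)).toLinearEquiv.finiteDimensional
  have hsep : Algebra.IsSeparable K L := by
    have : Algebra.IsSeparable K (IntermediateField.adjoin K (Set.range x)) := by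
      rw [IntermediateField.isSeparable_adjoin_iff_isSeparable]
      rintro _ ⟨i, rfl⟩
      exact hls _ (hxV i)
    rw [htopK] at this
    exact Algebra.IsSeparable.of_algHom K _
      (IntermediateField.topEquiv (F := K) (E := L)).symm.toAlgHom
  have hVtop : IntermediateField.adjoin K (V : Set L) = ⊤ := by
    rw [eq_top_iff, ← htopK]
    exact IntermediateField.adjoin.mono K _ _ (by rintro _ ⟨i, rfl⟩; exact hxV i)
  obtain ⟨u, huV, hu⟩ := exists_mem_adjoin_simple_eq_top K V hVtop
  have hux := span_range_le_formsAt_one x huV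
  exact ⟨Module.finrank K L, fun m ↦ ⟨finrank_formsAt_le_sum hx hlx hl hint hux hu m,
    finrank_mul_choose_le_finrank_formsAt hlx hl hux hu m⟩⟩

/-- The Hilbert function of a homogeneous prime over an infinite perfect field. -/
theorem exists_bounds_hilbertFunction_of_isPrime [Infinite k] [PerfectField k]
    {Q : Ideal (MvPolynomial (Fin (n + 1)) k)} [Q.IsPrime] (hQ : IsHomogeneousIdeal Q)
    (hd : HasDim Q d) :
    ∃ r : ℕ, ∀ m,
      hilbertFunction Q m ≤ ∑ i ∈ Finset.range r, (m + i + d).choose d ∧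
      r * (m + d).choose d ≤ hilbertFunction Q (m + r) := by
  -- The coordinates of the generic point: evaluation there has kernel exactly $Q$.
  let L := FractionRing (MvPolynomial (Fin (n + 1)) k ⧸ Q)
  let φ : MvPolynomial (Fin (n + 1)) k →ₐ[k] L :=
    (IsScalarTower.toAlgHom k (MvPolynomial (Fin (n + 1)) k ⧸ Q) L).comp (Ideal.Quotient.mkₐ k Q)
  let x : Fin (n + 1) → L := fun i ↦ φ (X i)
  have hφ : aeval x = φ := by
    ext i
    simp [x]
  have hker : ∀ f, aeval x f = 0 ↔ f ∈ Q := by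
    intro f
    rw [hφ, ← Ideal.Quotient.eq_zero_iff_mem]
    exact map_eq_zero_iff _ (IsFractionRing.injective (MvPolynomial (Fin (n + 1)) k ⧸ Q) L)
  have hfin : ∀ m, hilbertFunction Q m = Module.finrank k (formsAt (k := k) x m) := by
    intro m
    have : formsAt (k := k) x m = LinearMap.range
        ((aeval x).toLinearMap ∘ₗ (homogeneousSubmodule (Fin (n + 1)) k m).subtype) := by
      rw [LinearMap.range_comp, Submodule.range_subtype]
      rfl
    rw [hilbertFunction_eq_finrank_range, this]
    refine finrank_range_eq_of_ker_eq _ _ ?_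
    ext f
    rw [mem_ker_formsToQuotient]
    exact hker f
  have hrange : ringKrullDim (aeval (R := k) x).range = d + 1 := by
    rw [← hd]
    have hk : RingHom.ker (aeval (R := k) x) = Q := by
      ext f
      exact hker f
    exact (ringKrullDim_eq_of_ringEquiv ((Ideal.quotEquivOfEq hk.symm).trans
      (Ideal.quotientKerEquivRange (aeval (R := k) x)).toRingEquiv)).symm
  have htop : IntermediateField.adjoin k (Set.range x) = ⊤ := by
    rw [eq_top_iff]
    intro y _
    obtain ⟨a, b, -, rfl⟩ := IsFractionRing.div_surjective
      (A := MvPolynomial (Fin (n + 1)) k ⧸ Q) y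
    have h : ∀ a : MvPolynomial (Fin (n + 1)) k ⧸ Q,
        algebraMap _ L a ∈ IntermediateField.adjoin k (Set.range x) := by
      intro a
      obtain ⟨f, rfl⟩ := Ideal.Quotient.mk_surjective a
      refine IntermediateField.algebra_adjoin_le_adjoin k (Set.range x) ?_
      rw [Algebra.adjoin_range_eq_range_aeval]
      exact ⟨f, by rw [hφ]; rfl⟩
    exact div_mem (h a) (h b)
  simp_rw [hfin]
  refine exists_bounds_of_adjoin_eq_top x htop (fun f hf m ↦ ?_) hrange
  rw [hker] at hf ⊢
  exact isHomogeneousIdeal_iff.mp hQ f hf m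

end Prime

/-! ### Leading coefficients, binomial sums and the degree. -/

section RationalPolynomials

theorem leadingCoeff_nonneg_of_forall_nat_le {p : Polynomial ℚ} {m₀ : ℕ}
    (h : ∀ m : ℕ, m₀ ≤ m → 0 ≤ p.eval (m : ℚ)) : 0 ≤ p.leadingCoeff := by
  by_contra! hlt
  by_cases hdeg : 0 < p.degree
  · have ht := (p.tendsto_atBot_of_leadingCoeff_nonpos hdeg hlt.le).comp
      (tendsto_natCast_atTop_atTop (R := ℚ))
    obtain ⟨m, hm, hm'⟩ := ((ht.eventually (Filter.eventually_lt_atBot 0)).and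
      (Filter.eventually_ge_atTop m₀)).exists
    exact absurd (h m hm') (not_le.mpr hm)
  · have hC := Polynomial.eq_C_of_degree_le_zero (not_lt.mp hdeg)
    rw [hC, Polynomial.leadingCoeff_C] at hlt
    have := h m₀ le_rfl
    rw [hC, Polynomial.eval_C] at this
    exact absurd this (not_le.mpr hlt)

theorem coeff_nonneg_of_forall_nat_le {p : Polynomial ℚ} {m₀ d : ℕ} (hd : p.natDegree ≤ d)
    (h : ∀ m : ℕ, m₀ ≤ m → 0 ≤ p.eval (m : ℚ)) : 0 ≤ p.coeff d := by
  obtain hlt | rfl := hd.lt_or_eq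
  · rw [Polynomial.coeff_eq_zero_of_natDegree_lt hlt]
  · exact leadingCoeff_nonneg_of_forall_nat_le h

theorem natDegree_le_of_forall_nat_le {p q : Polynomial ℚ} {m₀ d : ℕ} (hq : q.natDegree ≤ d)
    (h0 : ∀ m : ℕ, m₀ ≤ m → 0 ≤ p.eval (m : ℚ))
    (hpq : ∀ m : ℕ, m₀ ≤ m → p.eval (m : ℚ) ≤ q.eval (m : ℚ)) : p.natDegree ≤ d := by
  by_contra! hd
  have h1 := leadingCoeff_nonneg_of_forall_nat_le h0
  have h2 : 0 ≤ (q - p).leadingCoeff := leadingCoeff_nonneg_of_forall_nat_le (m₀ := m₀) (by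
    intro m hm
    rw [Polynomial.eval_sub, sub_nonneg]
    exact hpq m hm)
  have hdeg : q.degree < p.degree := Polynomial.degree_lt_degree (hq.trans_lt hd)
  rw [Polynomial.leadingCoeff_sub_of_degree_lt' hdeg] at h2
  have : p.leadingCoeff = 0 := by linarith
  rw [Polynomial.leadingCoeff_eq_zero] at this
  simp [this] at hd

end RationalPolynomials

section ChooseSum

theorem sum_choose_mono_left {d r s : ℕ} (h : r ≤ s) (m : ℕ) :
    ∑ i ∈ Finset.range r, (m + i + d).choose d ≤ ∑ i ∈ Finset.range s, (m + i + d).choose d :=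
  Finset.sum_le_sum_of_subset (Finset.range_mono h)

/-- Placing the blocks of indices end to end only shifts indices upwards, and the summands increase
with $i$. -/
theorem sum_sum_choose_le {ι : Type*} (s : Finset ι) (r : ι → ℕ) (d m : ℕ) :
    ∑ j ∈ s, ∑ i ∈ Finset.range (r j), (m + i + d).choose d ≤
      ∑ i ∈ Finset.range (∑ j ∈ s, r j), (m + i + d).choose d := by
  classical
  induction s using Finset.induction_on with
  | empty => simp
  | insert a s ha ih =>
    rw [Finset.sum_insert ha, Finset.sum_insert ha, add_comm (r a), Finset.sum_range_add, add_comm]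
    refine add_le_add ih (Finset.sum_le_sum fun i _ ↦ Nat.choose_le_choose d ?_)
    omega

theorem sum_choose_add_choose (d m r : ℕ) :
    ∑ i ∈ Finset.range r, (m + i + d).choose d + (m + d).choose (d + 1) =
      (m + r + d).choose (d + 1) := by
  induction r with
  | zero => simp
  | succ r ih =>
    rw [Finset.sum_range_succ, add_right_comm, ih, show m + (r + 1) + d = (m + r + d) + 1 by ring,
      Nat.choose_succ_succ, add_comm]

end ChooseSum

section Degree

variable {k : Type*} [Field k] {n : ℕ}

/-- The upper bound serves only to give the Hilbert polynomial degree at most $d$. The lower bound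
then compares its coefficient of $t^d$ with $r/d!$; the shift $c$ is invisible there. -/
theorem le_degree_of_bounds {I : Ideal (MvPolynomial (Fin (n + 1)) k)}
    (hI : IsHomogeneousIdeal I) {d r c : ℕ}
    (hupper : ∀ m, hilbertFunction I m ≤ ∑ i ∈ Finset.range r, (m + i + d).choose d)
    (hlower : ∀ m, r * (m + d).choose d ≤ hilbertFunction I (m + c)) : r ≤ degree I d := by
  obtain ⟨m₀, hp⟩ := isHilbertPolynomial_hilbertPolynomial hI
  set p := hilbertPolynomial I
  have hdeg : p.natDegree ≤ d := by
    refine natDegree_le_of_forall_nat_le (m₀ := m₀)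
      (q := ∑ i ∈ Finset.range r, (Polynomial.preHilbertPoly ℚ d 0).comp
        (Polynomial.X + Polynomial.C (i : ℚ))) ?_ ?_ ?_
    · refine Polynomial.natDegree_sum_le_of_forall_le _ _ fun i _ ↦ ?_
      refine Polynomial.natDegree_comp_le.trans ?_
      rw [Polynomial.natDegree_preHilbertPoly, Polynomial.natDegree_X_add_C, mul_one]
    · intro m hm
      rw [← hp m hm]
      positivity
    · intro m hm
      rw [← hp m hm, Polynomial.eval_finsetSum]
      have := hupper m
      refine (show (hilbertFunction I m : ℚ) ≤
        ((∑ i ∈ Finset.range r, (m + i + d).choose d : ℕ) : ℚ) by exact_mod_cast this).trans ?_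
      rw [Nat.cast_sum]
      refine Finset.sum_le_sum fun i _ ↦ ?_
      rw [Polynomial.eval_comp]
      simp only [Polynomial.eval_add, Polynomial.eval_X, Polynomial.eval_C]
      rw [← Nat.cast_add, Polynomial.preHilbertPoly_eq_choose_sub_add ℚ d (Nat.zero_le _)]
      simp
  have hcoeff : 0 ≤ (p - (r : ℚ) • Polynomial.preHilbertPoly ℚ d c).coeff d := by
    refine coeff_nonneg_of_forall_nat_le (m₀ := m₀ + c) ?_ fun m hm ↦ ?_
    · refine (Polynomial.natDegree_sub_le_of_le hdeg (Polynomial.natDegree_smul_le _ _)).trans ?_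
      simp [Polynomial.natDegree_preHilbertPoly]
    · rw [Polynomial.eval_sub, ← hp m (by omega), Polynomial.eval_smul,
        Polynomial.preHilbertPoly_eq_choose_sub_add ℚ d (by omega), sub_nonneg, smul_eq_mul]
      have := hlower (m - c)
      rw [Nat.sub_add_cancel (by omega)] at this
      exact_mod_cast this
  rw [Polynomial.coeff_sub, Polynomial.coeff_smul, Polynomial.coeff_preHilbertPoly_self,
    sub_nonneg, smul_eq_mul] at hcoeff
  rw [degree]
  refine Nat.le_floor ?_
  have hfac : (0 : ℚ) < d.factorial := by exact_mod_cast d.factorial_pos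
  calc (r : ℚ) = d.factorial * (r * (d.factorial : ℚ)⁻¹) := by field_simp
    _ ≤ _ := by gcongr

end Degree

/-! ### Decomposition along minimal primes. -/

section MinimalPrimes

variable {k : Type*} [Field k] {n : ℕ}

/-- The homogeneous core of $P$ is a prime between $I$ and $P$, hence equals $P$. -/
theorem IsHomogeneousIdeal.of_mem_minimalPrimes {I P : Ideal (MvPolynomial (Fin (n + 1)) k)}
    (hI : IsHomogeneousIdeal I) (hP : P ∈ I.minimalPrimes) : IsHomogeneousIdeal P := by
  let _ := MvPolynomial.gradedAlgebra (σ := Fin (n + 1)) (R := k)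
  let C := P.homogeneousCore (homogeneousSubmodule (Fin (n + 1)) k)
  have hCP : C.toIdeal ≤ P := Ideal.toIdeal_homogeneousCore_le _ P
  have hIC : I ≤ C.toIdeal := by
    have h1 : I = (I.homogeneousCore (homogeneousSubmodule (Fin (n + 1)) k)).toIdeal :=
      (Ideal.IsHomogeneous.toIdeal_homogeneousCore_eq_self hI).symm
    rw [h1]
    exact Ideal.homogeneousCore_mono _ hP.1.2
  have hC : C.toIdeal.IsPrime := Ideal.IsPrime.homogeneousCore hP.1.1
  have heq : P = C.toIdeal := le_antisymm (hP.2 ⟨hC, hIC⟩ hCP) hCP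
  rw [heq]
  exact C.isHomogeneous

theorem exists_homogeneous_mem_of_ne {ι : Type*} (s : Finset ι)
    {P : ι → Ideal (MvPolynomial (Fin (n + 1)) k)} (hP : ∀ i, IsHomogeneousIdeal (P i))
    {j : ι} (hPj : (P j).IsPrime) (hne : ∀ i ∈ s, ¬ P i ≤ P j) :
    ∃ (c : ℕ) (e : MvPolynomial (Fin (n + 1)) k),
      e.IsHomogeneous c ∧ e ∉ P j ∧ ∀ i ∈ s, e ∈ P i := by
  have h : ¬ s.inf P ≤ P j := by
    rw [hPj.inf_le']
    push Not
    exact hne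
  obtain ⟨f, hf, hfj⟩ := SetLike.not_le_iff_exists.mp h
  obtain ⟨c, hc⟩ : ∃ c, homogeneousComponent c f ∉ P j := by
    by_contra! h
    apply hfj
    rw [← sum_homogeneousComponent f]
    exact Submodule.sum_mem _ fun i _ ↦ h i
  refine ⟨c, _, homogeneousComponent_isHomogeneous c f, hc, fun i hi ↦ ?_⟩
  exact isHomogeneousIdeal_iff.mp (hP i) f (Finset.inf_le (f := P) hi hf) c

variable {ι : Type*} [Fintype ι] {I : Ideal (MvPolynomial (Fin (n + 1)) k)}
  {P : ι → Ideal (MvPolynomial (Fin (n + 1)) k)}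

theorem finrank_range_pi {V W : ι → Type*} [∀ i, AddCommGroup (V i)] [∀ i, Module k (V i)]
    [∀ i, FiniteDimensional k (V i)] [∀ i, AddCommGroup (W i)] [∀ i, Module k (W i)]
    (f : ∀ i, V i →ₗ[k] W i) :
    Module.finrank k (LinearMap.range (LinearMap.pi fun i ↦ f i ∘ₗ LinearMap.proj i)) =
      ∑ i, Module.finrank k (LinearMap.range (f i)) := by
  rw [← Module.finrank_pi_fintype]
  let g : (∀ i, V i) →ₗ[k] (∀ i, LinearMap.range (f i)) :=
    LinearMap.pi fun i ↦ (f i).rangeRestrict ∘ₗ LinearMap.proj i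
  have hg : LinearMap.range g = ⊤ := by
    rw [LinearMap.range_eq_top]
    intro y
    choose v hv using fun i ↦ (f i).surjective_rangeRestrict (y i)
    exact ⟨v, funext hv⟩
  rw [← finrank_top k (∀ i, LinearMap.range (f i)), ← hg]
  refine finrank_range_eq_of_ker_eq _ _ ?_
  ext v
  simp only [LinearMap.mem_ker, funext_iff]
  exact forall_congr' fun i ↦ by simp [g, Subtype.ext_iff]

theorem hilbertFunction_le_sum (hPI : ∀ f, (∀ i, f ∈ P i) → f ∈ I) (m : ℕ) :
    hilbertFunction I m ≤ ∑ i, hilbertFunction (P i) m := by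
  simp_rw [hilbertFunction_eq_finrank_range]
  rw [← finrank_range_pi]
  refine le_trans (finrank_range_le_of_ker_le
    (LinearMap.pi fun i ↦ formsToQuotient (P i) m) _ fun f hf ↦ ?_) ?_
  · rw [mem_ker_formsToQuotient]
    refine hPI _ fun i ↦ mem_ker_formsToQuotient.mp (congrFun hf i)
  · refine Submodule.finrank_mono ?_
    rintro _ ⟨f, rfl⟩
    exact ⟨fun _ ↦ f, rfl⟩

/-- Consider $(v_i)\mapsto\sum e_iv_i$ modulo $I$. Reduction modulo $P_j$ leaves only $e_jv_j$, and
$e_j\notin P_j$, so a vanishing sum forces $v_j\in P_j$. -/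
theorem sum_hilbertFunction_le (hIP : ∀ i, I ≤ P i)
    (hP : ∀ i, (P i).IsPrime) {c : ι → ℕ} {e : ι → MvPolynomial (Fin (n + 1)) k}
    (hc : ∀ i, (e i).IsHomogeneous (c i)) (he : ∀ i, e i ∉ P i)
    (he' : ∀ i j, j ≠ i → e i ∈ P j) {m : ℕ} (hm : ∀ i, c i ≤ m) :
    ∑ i, hilbertFunction (P i) (m - c i) ≤ hilbertFunction I m := by
  classical
  simp_rw [hilbertFunction_eq_finrank_range]
  rw [← finrank_range_pi]
  let T : (∀ i, homogeneousSubmodule (Fin (n + 1)) k (m - c i)) →ₗ[k]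
      (MvPolynomial (Fin (n + 1)) k ⧸ I) :=
    (Ideal.Quotient.mkₐ k I).toLinearMap ∘ₗ ∑ i, LinearMap.mulLeft k (e i) ∘ₗ
      (homogeneousSubmodule (Fin (n + 1)) k (m - c i)).subtype ∘ₗ LinearMap.proj i
  have hT : ∀ v, T v = Ideal.Quotient.mk I (∑ i, e i * (v i : MvPolynomial (Fin (n + 1)) k)) := by
    intro v
    simp [T]
  refine (finrank_range_le_of_ker_le T _ fun v hv ↦ ?_).trans (Submodule.finrank_mono ?_)
  · rw [LinearMap.mem_ker, hT, Ideal.Quotient.eq_zero_iff_mem] at hv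
    rw [LinearMap.mem_ker]
    ext j
    have h1 := hIP j hv
    rw [← Finset.add_sum_erase _ _ (Finset.mem_univ j)] at h1
    have h2 : ∑ i ∈ Finset.univ.erase j, e i * (v i : MvPolynomial (Fin (n + 1)) k) ∈ P j :=
      Submodule.sum_mem _ fun i hi ↦
        (P j).mul_mem_right _ (he' i j (Finset.ne_of_mem_erase hi).symm)
    have h3 := ((P j).add_mem_iff_left h2).mp h1
    exact mem_ker_formsToQuotient.mpr (((hP j).mem_or_mem h3).resolve_left (he j))
  · rintro _ ⟨v, rfl⟩
    refine ⟨⟨∑ i, e i * (v i : MvPolynomial (Fin (n + 1)) k), ?_⟩, (hT v).symm⟩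
    refine Submodule.sum_mem _ fun i _ ↦ ?_
    have := (hc i).mul (v i).2
    rwa [Nat.add_sub_cancel' (hm i)] at this

end MinimalPrimes

section Radical

variable {k : Type*} [Field k] {n d : ℕ}

/-- The bound for the Hilbert function over an infinite perfect field. -/
theorem hilbertFunction_le_of_infinite [Infinite k] [PerfectField k]
    {I : Ideal (MvPolynomial (Fin (n + 1)) k)} (hI : IsHomogeneousIdeal I) (hrad : I.IsRadical)
    (hdim : ∀ P ∈ I.minimalPrimes, HasDim P d) (m : ℕ) :
    hilbertFunction I m ≤ ∑ i ∈ Finset.range (degree I d), (m + i + d).choose d := by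
  classical
  have := (Ideal.finite_minimalPrimes_of_isNoetherianRing _ I).fintype
  let P : I.minimalPrimes → Ideal (MvPolynomial (Fin (n + 1)) k) := Subtype.val
  have hP : ∀ i, (P i).IsPrime := fun i ↦ i.2.1.1
  have hPhom : ∀ i, IsHomogeneousIdeal (P i) := fun i ↦ hI.of_mem_minimalPrimes i.2
  have hIP : ∀ i, I ≤ P i := fun i ↦ i.2.1.2
  have hPI : ∀ f, (∀ i, f ∈ P i) → f ∈ I := by
    intro f hf
    rw [← hrad.radical, ← Ideal.sInf_minimalPrimes, Submodule.mem_sInf]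
    exact fun Q hQ ↦ hf ⟨Q, hQ⟩
  choose r hr using fun i ↦ exists_bounds_hilbertFunction_of_isPrime (hPhom i) (hdim _ i.2)
  have hupper : ∀ m, hilbertFunction I m ≤
      ∑ i ∈ Finset.range (∑ j, r j), (m + i + d).choose d := fun m ↦
    (hilbertFunction_le_sum hPI m).trans
      ((Finset.sum_le_sum fun i _ ↦ (hr i m).1).trans (sum_sum_choose_le _ _ _ _))
  refine (hupper m).trans (sum_choose_mono_left ?_ m)
  have hex : ∀ j, ∃ (c : ℕ) (e : MvPolynomial (Fin (n + 1)) k),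
      e.IsHomogeneous c ∧ e ∉ P j ∧ ∀ i ∈ Finset.univ.erase j, e ∈ P i := fun j ↦
    exists_homogeneous_mem_of_ne _ hPhom (hP j) fun i hi hle ↦
      (Finset.ne_of_mem_erase hi) (Subtype.ext (le_antisymm hle (j.2.2 i.2.1 hle)))
  choose c e hc he he' using hex
  -- A single shift large enough for all components: it absorbs $\deg e_i=c_i$ and the shift $r_i$
  -- in the bound for $P_i$.
  refine le_degree_of_bounds hI (c := ∑ i, (c i + r i)) hupper fun m ↦ ?_
  have hci : ∀ i, c i + r i ≤ ∑ i, (c i + r i) := fun i ↦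
    Finset.single_le_sum (f := fun i ↦ c i + r i) (fun _ _ ↦ Nat.zero_le _) (Finset.mem_univ i)
  refine le_trans ?_ (sum_hilbertFunction_le hIP hP hc he
    (fun i j hij ↦ he' i j (Finset.mem_erase.mpr ⟨hij, Finset.mem_univ _⟩))
    (fun i ↦ by have := hci i; omega))
  rw [Finset.sum_mul]
  refine Finset.sum_le_sum fun i _ ↦ ?_
  obtain ⟨a, ha⟩ := Nat.exists_eq_add_of_le (hci i)
  have h := (hr i (m + a)).2
  rw [show m + ∑ i, (c i + r i) - c i = m + a + r i by omega]
  exact (Nat.mul_le_mul_left _ (Nat.choose_le_choose d (by omega))).trans h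

end Radical

/-! ### Radical ideals under extension of a perfect field. -/

section CoefficientwiseFunctional

variable {k K σ : Type*} [Field k] [Field K] [Algebra k K]

/-- Apply a `k`-linear functional on `K` to the coefficients of a polynomial. -/
noncomputable def coeffFunctional (φ : K →ₗ[k] k) (f : MvPolynomial σ K) : MvPolynomial σ k :=
  ∑ d ∈ f.support, monomial d (φ (coeff d f))

@[simp] theorem coeff_coeffFunctional (φ : K →ₗ[k] k) (f : MvPolynomial σ K) (d : σ →₀ ℕ) :
    coeff d (coeffFunctional φ f) = φ (coeff d f) := by
  classical
  rw [coeffFunctional, coeff_sum]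
  simp only [coeff_monomial, Finset.sum_ite_eq']
  split_ifs with h
  · rfl
  · rw [notMem_support_iff.mp h, map_zero]

theorem coeffFunctional_zero (φ : K →ₗ[k] k) :
    coeffFunctional φ (0 : MvPolynomial σ K) = 0 := by
  ext d; simp

theorem coeffFunctional_add (φ : K →ₗ[k] k) (f g : MvPolynomial σ K) :
    coeffFunctional φ (f + g) = coeffFunctional φ f + coeffFunctional φ g := by
  ext d; simp

theorem coeffFunctional_sum {ι : Type*} (φ : K →ₗ[k] k) (s : Finset ι)
    (f : ι → MvPolynomial σ K) :
    coeffFunctional φ (∑ i ∈ s, f i) = ∑ i ∈ s, coeffFunctional φ (f i) := by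
  ext d; simp [coeff_sum]

theorem coeffFunctional_mul_map (φ : K →ₗ[k] k) (f : MvPolynomial σ K) (g : MvPolynomial σ k) :
    coeffFunctional φ (f * map (algebraMap k K) g) = coeffFunctional φ f * g := by
  classical
  ext d
  rw [coeff_coeffFunctional, coeff_mul, coeff_mul, map_sum]
  refine Finset.sum_congr rfl fun x _ ↦ ?_
  rw [coeff_map, mul_comm, ← Algebra.smul_def, map_smul, coeff_coeffFunctional, smul_eq_mul,
    mul_comm]

theorem coeffFunctional_C (φ : K →ₗ[k] k) (c : K) :
    coeffFunctional φ (C c : MvPolynomial σ K) = C (φ c) := by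
  classical
  ext d
  rw [coeff_coeffFunctional, coeff_C, coeff_C]
  split_ifs <;> simp

theorem coeffFunctional_mem {I : Ideal (MvPolynomial σ k)} {f : MvPolynomial σ K}
    (hf : f ∈ I.map (map (algebraMap k K))) (φ : K →ₗ[k] k) : coeffFunctional φ f ∈ I := by
  -- `coeffFunctional` is not linear over $K[x]$; the multiplier $g$ makes the span induction close.
  suffices h : ∀ g, coeffFunctional φ (g * f) ∈ I by simpa using h 1
  induction hf using Submodule.span_induction with
  | mem x hx =>
    obtain ⟨y, hy, rfl⟩ := hx
    intro g
    rw [coeffFunctional_mul_map]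
    exact I.mul_mem_left _ hy
  | zero => intro g; rw [mul_zero, coeffFunctional_zero]; exact I.zero_mem
  | add x y _ _ hx hy =>
    intro g
    rw [mul_add, coeffFunctional_add]
    exact I.add_mem (hx g) (hy g)
  | smul a x _ hx =>
    intro g
    rw [smul_eq_mul, ← mul_assoc]
    exact hx _

theorem exists_eq_sum_C_mul_map {ι : Type*} (b : Module.Basis ι k K) (f : MvPolynomial σ K) :
    ∃ s : Finset ι, f = ∑ i ∈ s, C (b i) * map (algebraMap k K) (coeffFunctional (b.coord i) f) := by
  classical
  refine ⟨f.support.biUnion fun d ↦ (b.repr (coeff d f)).support, ?_⟩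
  ext d
  rw [coeff_sum]
  simp only [coeff_C_mul, coeff_map, coeff_coeffFunctional, Module.Basis.coord_apply]
  by_cases hd : d ∈ f.support
  · conv_lhs => rw [← b.linearCombination_repr (coeff d f), Finsupp.linearCombination_apply]
    rw [Finsupp.sum_of_support_subset (s := f.support.biUnion fun d ↦ (b.repr (coeff d f)).support)
      _ (Finset.subset_biUnion_of_mem (fun d ↦ (b.repr (coeff d f)).support) hd) _ (by simp)]
    exact Finset.sum_congr rfl fun i _ ↦ by rw [Algebra.smul_def, mul_comm]
  · rw [notMem_support_iff.mp hd]
    simp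

theorem mem_map_iff_coeffFunctional_mem {I : Ideal (MvPolynomial σ k)} {f : MvPolynomial σ K} :
    f ∈ I.map (map (algebraMap k K)) ↔ ∀ φ : K →ₗ[k] k, coeffFunctional φ f ∈ I := by
  refine ⟨fun h φ ↦ coeffFunctional_mem h φ, fun h ↦ ?_⟩
  obtain ⟨s, hs⟩ := exists_eq_sum_C_mul_map (Module.Basis.ofVectorSpace k K) f
  rw [hs]
  exact Submodule.sum_mem _ fun i _ ↦ Ideal.mul_mem_left _ _ (Ideal.mem_map_of_mem _ (h _))

/-- Write $f=\sum b_if_i$ for a basis $(b_i)$ of $K/k$, so $f^p=\sum b_i^pf_i^p$. As $k$ is perfect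
the $b_i^p$ are independent, so a functional isolates $f_j^p\in I$, and $f_j\in I$ by radicality. -/
theorem mem_map_of_pow_mem [PerfectField k] {p : ℕ} [Fact p.Prime] [CharP k p]
    {I : Ideal (MvPolynomial σ k)} (hI : I.IsRadical) {f : MvPolynomial σ K}
    (hf : f ^ p ∈ I.map (map (algebraMap k K))) : f ∈ I.map (map (algebraMap k K)) := by
  classical
  have hp : p.Prime := Fact.out
  have : ExpChar k p := .prime hp
  have : CharP K p := .of_ringHom_of_ne_zero (algebraMap k K) p hp.ne_zero
  let b := Module.Basis.ofVectorSpace k K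
  have hli : LinearIndependent k fun i ↦ b i ^ p := by
    apply b.linearIndependent.map_of_injective_injective (frobeniusEquiv k p).symm
      (frobenius K p).toAddMonoidHom
    · simp
    · simp
    · intro r x
      change ((frobeniusEquiv k p).symm r • x) ^ p = r • x ^ p
      rw [Algebra.smul_def, mul_pow, ← map_pow, frobeniusEquiv_symm_pow_p, Algebra.smul_def]
  obtain ⟨s, hs⟩ := exists_eq_sum_C_mul_map b f
  rw [hs]
  refine Submodule.sum_mem _ fun j hj ↦ Ideal.mul_mem_left _ _ (Ideal.mem_map_of_mem _ (hI ?_))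
  refine ⟨p, ?_⟩
  obtain ⟨φ, hφ⟩ := ((Finsupp.lapply j).comp hli.repr).exists_extend
  have hφb : ∀ i, φ (b i ^ p) = if i = j then 1 else 0 := by
    intro i
    have h1 := LinearMap.congr_fun hφ ⟨b i ^ p, Submodule.subset_span ⟨i, rfl⟩⟩
    have h2 := hli.repr_eq_single i ⟨b i ^ p, Submodule.subset_span ⟨i, rfl⟩⟩ rfl
    have h3 : φ (b i ^ p) = hli.repr ⟨b i ^ p, Submodule.subset_span ⟨i, rfl⟩⟩ j := h1
    rw [h3, h2, Finsupp.single_apply]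
  have h := coeffFunctional_mem hf φ
  rw [hs, sum_pow_char, coeffFunctional_sum] at h
  simp only [mul_pow, ← map_pow, coeffFunctional_mul_map, coeffFunctional_C, hφb] at h
  rw [Finset.sum_eq_single j] at h
  · simpa using h
  · intro i _ hij
    simp [hij]
  · exact fun h ↦ absurd hj h

theorem isRadical_map [PerfectField k] {p : ℕ} [Fact p.Prime] [CharP k p]
    {I : Ideal (MvPolynomial σ k)} (hI : I.IsRadical) :
    (I.map (map (algebraMap k K) : MvPolynomial σ k →+* MvPolynomial σ K)).IsRadical := by
  rintro f ⟨N, hN⟩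
  have hp : p.Prime := Fact.out
  have h : ∀ e : ℕ, f ^ p ^ e ∈ I.map (map (algebraMap k K)) →
      f ∈ I.map (map (algebraMap k K)) := by
    intro e
    induction e with
    | zero => intro h; simpa using h
    | succ e ih =>
      intro h
      rw [pow_succ, pow_mul] at h
      exact ih (mem_map_of_pow_mem hI h)
  exact h N (Ideal.pow_mem_of_pow_mem _ hN (Nat.lt_pow_self hp.one_lt).le)

end CoefficientwiseFunctional

/-! ### Invariance of Hilbert function, degree and dimension under base change. -/

section BaseChange

variable {k : Type*} [Field k] (K : Type*) [Field K] [Algebra k K] {n : ℕ}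

/-- The extension of an ideal to the polynomial ring over a larger field. -/
noncomputable abbrev extendScalars (I : Ideal (MvPolynomial (Fin (n + 1)) k)) :
    Ideal (MvPolynomial (Fin (n + 1)) K) :=
  I.map (map (algebraMap k K))

variable {K} {I : Ideal (MvPolynomial (Fin (n + 1)) k)}

theorem IsHomogeneousIdeal.extendScalars (hI : IsHomogeneousIdeal I) :
    IsHomogeneousIdeal (extendScalars K I) := by
  rw [isHomogeneousIdeal_iff] at hI ⊢
  intro f hf m
  rw [mem_map_iff_coeffFunctional_mem]
  intro φ
  have h : coeffFunctional φ (homogeneousComponent m f) =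
      homogeneousComponent m (coeffFunctional φ f) := by
    ext d
    rw [coeff_coeffFunctional, coeff_homogeneousComponent, coeff_homogeneousComponent,
      coeff_coeffFunctional]
    split_ifs <;> simp
  rw [h]
  exact hI _ (coeffFunctional_mem hf φ) m

variable (K I) in
theorem hilbertFunction_extendScalars (m : ℕ) :
    hilbertFunction (extendScalars K I) m = hilbertFunction I m := by
  rw [hilbertFunction_eq_finrank_range, hilbertFunction_eq_finrank_range]
  set T := LinearMap.range (formsToQuotient I m)
  -- A $k$-basis of $(R/I)_m$, lifted to forms, becomes a $K$-basis after extension; independence is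
  -- tested by functionals $K\to k$.
  let t := Module.finBasis k T
  choose v hv using fun j ↦ (t j).2
  let w : Fin (Module.finrank k T) → (MvPolynomial (Fin (n + 1)) K ⧸ extendScalars K I) := fun j ↦
    Ideal.Quotient.mk _ (map (algebraMap k K) (v j : MvPolynomial (Fin (n + 1)) k))
  have hw : LinearIndependent K w := by
    rw [Fintype.linearIndependent_iff]
    intro c hc
    have h1 : ∑ j, C (c j) * map (algebraMap k K) (v j : MvPolynomial (Fin (n + 1)) k) ∈
        extendScalars K I := by
      rw [← Ideal.Quotient.eq_zero_iff_mem, ← hc, map_sum]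
      refine Finset.sum_congr rfl fun j _ ↦ ?_
      rw [← MvPolynomial.smul_eq_C_mul]
      rfl
    have h2 : ∀ (φ : K →ₗ[k] k) (j), φ (c j) = 0 := by
      intro φ
      have h3 := coeffFunctional_mem h1 φ
      simp only [coeffFunctional_sum, coeffFunctional_mul_map, coeffFunctional_C] at h3
      have h4 : ∑ j, φ (c j) • t j = 0 := by
        ext
        rw [← Ideal.Quotient.eq_zero_iff_mem, map_sum] at h3
        rw [AddSubmonoidClass.coe_finsetSum, ZeroMemClass.coe_zero, ← h3]
        refine Finset.sum_congr rfl fun j _ ↦ ?_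
        rw [SetLike.val_smul, ← hv j, ← MvPolynomial.smul_eq_C_mul]
        rfl
      exact Fintype.linearIndependent_iff.mp t.linearIndependent _ h4
    intro j
    exact (Module.forall_dual_apply_eq_zero_iff k (c j)).mp fun φ ↦ h2 φ j
  have hspan : LinearMap.range (formsToQuotient (extendScalars K I) m) =
      Submodule.span K (Set.range w) := by
    apply le_antisymm
    · rintro _ ⟨⟨f, hf⟩, rfl⟩
      change Ideal.Quotient.mk _ f ∈ _
      rw [congrArg (Ideal.Quotient.mk (extendScalars K I)) f.as_sum, map_sum]
      refine Submodule.sum_mem _ fun d hd ↦ ?_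
      have hdm : (monomial d (1 : k)).IsHomogeneous m :=
        isHomogeneous_monomial 1 (by
          rw [Finsupp.degree_eq_weight_one]
          exact hf (mem_support_iff.mp hd))
      have hmem : Ideal.Quotient.mk (extendScalars K I) (monomial d (1 : K)) ∈
          Submodule.span K (Set.range w) := by
        let y : T := ⟨_, LinearMap.mem_range_self (formsToQuotient I m) ⟨_, hdm⟩⟩
        have h1 : monomial d (1 : k) - ∑ j, C (t.repr y j) * (v j : MvPolynomial _ k) ∈ I := by
          rw [← Ideal.Quotient.eq_zero_iff_mem, map_sub, sub_eq_zero]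
          have h2 := congrArg (Subtype.val) (t.sum_repr y)
          rw [AddSubmonoidClass.coe_finsetSum] at h2
          refine h2.symm.trans ?_
          rw [map_sum]
          refine Finset.sum_congr rfl fun j _ ↦ ?_
          rw [SetLike.val_smul, ← hv j, ← MvPolynomial.smul_eq_C_mul]
          rfl
        have h3 := Ideal.mem_map_of_mem (map (algebraMap k K)) h1
        rw [← Ideal.Quotient.eq_zero_iff_mem, map_sub, map_sub, sub_eq_zero, map_monomial, map_one]
          at h3
        rw [h3, map_sum, map_sum]
        refine Submodule.sum_mem _ fun j _ ↦ ?_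
        rw [map_mul, map_C, ← MvPolynomial.smul_eq_C_mul]
        exact Submodule.smul_mem _ _ (Submodule.subset_span (Set.mem_range_self j))
      have hsm : monomial d (coeff d f) = coeff d f • monomial d (1 : K) := by
        simp [smul_monomial]
      rw [hsm]
      exact Submodule.smul_mem _ _ hmem
    · rw [Submodule.span_le]
      rintro _ ⟨j, rfl⟩
      exact ⟨⟨_, (v j).2.map (algebraMap k K)⟩, rfl⟩
  rw [hspan, finrank_span_eq_card hw, Fintype.card_fin]

variable (K I) in
theorem degree_extendScalars (d : ℕ) : degree (extendScalars K I) d = degree I d := by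
  have h : IsHilbertPolynomial (extendScalars K I) = IsHilbertPolynomial I := by
    ext p
    simp only [IsHilbertPolynomial, hilbertFunction_extendScalars]
  unfold degree hilbertPolynomial
  rw [h]

-- $K[x]$ is flat and integral over $k[x]$. Going down makes the contraction of $Q$ minimal over
-- $I$, and integrality preserves the dimension of the quotient.
attribute [local instance] MvPolynomial.algebraMvPolynomial in
theorem hasDim_of_mem_minimalPrimes_extendScalars [Algebra.IsIntegral k K] {d : ℕ}
    (hI : ∀ P ∈ I.minimalPrimes, HasDim P d) {Q : Ideal (MvPolynomial (Fin (n + 1)) K)}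
    (hQ : Q ∈ (extendScalars K I).minimalPrimes) : HasDim Q d := by
  have hflat : Module.Flat (MvPolynomial (Fin (n + 1)) k) (MvPolynomial (Fin (n + 1)) K) :=
    Module.Flat.of_linearEquiv (Algebra.IsPushout.equiv k (MvPolynomial (Fin (n + 1)) k) K
      (MvPolynomial (Fin (n + 1)) K)).symm.toLinearEquiv
  have hint : Algebra.IsIntegral (MvPolynomial (Fin (n + 1)) k) (MvPolynomial (Fin (n + 1)) K) :=
    ⟨fun f ↦ MvPolynomial.isIntegral_iff_isIntegral_coeff.mpr fun _ ↦
      Algebra.IsIntegral.isIntegral _⟩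
  have hQp : Q.IsPrime := hQ.1.1
  let P := Q.comap (algebraMap (MvPolynomial (Fin (n + 1)) k) (MvPolynomial (Fin (n + 1)) K))
  have hPp : P.IsPrime := Ideal.comap_isPrime _ Q
  have hP : P ∈ I.minimalPrimes := by
    refine ⟨⟨hPp, Ideal.map_le_iff_le_comap.mp hQ.1.2⟩, fun P₀ ⟨hP₀, hIP₀⟩ hle ↦ ?_⟩
    have : Q.LiesOver P := ⟨rfl⟩
    obtain ⟨Q₀, hQ₀Q, hQ₀, hlies⟩ := Ideal.exists_ideal_le_liesOver_of_le Q hle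
    have hIQ₀ : extendScalars K I ≤ Q₀ := by
      refine Ideal.map_le_iff_le_comap.mpr (hIP₀.trans ?_)
      rw [hlies.over]
      rfl
    rw [hlies.over]
    exact Ideal.comap_mono (hQ.2 ⟨hQ₀, hIQ₀⟩ hQ₀Q)
  have h := ringKrullDim_eq_of_isIntegral
    (A := MvPolynomial (Fin (n + 1)) k ⧸ P) (B := MvPolynomial (Fin (n + 1)) K ⧸ Q)
    Ideal.algebraMap_quotient_injective
  exact h.trans (hI P hP)

end BaseChange

/-! ### Unmixed ideals and conclusion. -/

section Unmixed

variable {k : Type*} [Field k] {n d : ℕ} {I : Ideal (MvPolynomial (Fin (n + 1)) k)}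

theorem exists_mem_minimalPrimes_le_ringKrullDim {R : Type*} [CommRing R] {I : Ideal R} {d : ℕ}
    (h : (d : WithBot ℕ∞) ≤ ringKrullDim (R ⧸ I)) :
    ∃ P ∈ I.minimalPrimes, (d : WithBot ℕ∞) ≤ ringKrullDim (R ⧸ P) := by
  rw [ringKrullDim_quotient, Order.le_krullDim_iff] at h
  obtain ⟨s, rfl⟩ := h
  have hprime := s.head.1.2
  obtain ⟨P, hP, hle⟩ := Ideal.exists_minimalPrimes_le (J := s.head.1.asIdeal) s.head.2
  refine ⟨P, hP, ?_⟩
  rw [ringKrullDim_quotient, Order.le_krullDim_iff]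
  refine ⟨⟨s.length, fun i ↦ ⟨(s i).1, ?_⟩, fun i ↦ s.step i⟩, rfl⟩
  exact hle.trans (LTSeries.head_le s i)

/-- Minimal primes are associated, hence share one dimension, and some minimal prime attains that of
$I$. -/
theorem IsUnmixed.hasDim_of_mem_minimalPrimes (hI : IsUnmixed I) (hd : HasDim I d)
    {P : Ideal (MvPolynomial (Fin (n + 1)) k)} (hP : P ∈ I.minimalPrimes) : HasDim P d := by
  have hass : ∀ P ∈ I.minimalPrimes,
      P ∈ associatedPrimes (MvPolynomial (Fin (n + 1)) k) (MvPolynomial (Fin (n + 1)) k ⧸ I) := by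
    intro P hP
    refine Module.associatedPrimes.minimalPrimes_annihilator_subset_associatedPrimes _ _ ?_
    rwa [Ideal.annihilator_quotient]
  obtain ⟨Q, hQ, hQd⟩ := exists_mem_minimalPrimes_le_ringKrullDim (I := I) (d := d + 1)
    (by rw [show ringKrullDim _ = _ from hd]; push_cast; rfl)
  have hQ' : ringKrullDim (MvPolynomial (Fin (n + 1)) k ⧸ Q) = d + 1 := by
    refine le_antisymm ?_ (by exact_mod_cast hQd)
    rw [← show ringKrullDim _ = _ from hd]
    exact ringKrullDim_le_of_surjective (Ideal.Quotient.factor hQ.1.2)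
      (Ideal.Quotient.factor_surjective hQ.1.2)
  exact (hI P (hass P hP) Q (hass Q hQ)).trans hQ'

/-- The bound for the Hilbert function of a radical ideal with equidimensional minimal primes. -/
theorem hilbertFunction_le_sum_choose [PerfectField k] (hI : IsHomogeneousIdeal I)
    (hrad : I.IsRadical) (hdim : ∀ P ∈ I.minimalPrimes, HasDim P d) (m : ℕ) :
    hilbertFunction I m ≤ ∑ i ∈ Finset.range (degree I d), (m + i + d).choose d := by
  obtain hk | hk := finite_or_infinite k
  · obtain ⟨p, hp⟩ := CharP.exists k
    have : Fact p.Prime := ⟨CharP.char_is_prime k p⟩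
    -- The algebraic closure is infinite, perfect and integral over $k$, which is all that the
    -- transfer needs.
    have : Infinite (AlgebraicClosure k) := IsAlgClosed.instInfinite
    have h := hilbertFunction_le_of_infinite (hI.extendScalars (K := AlgebraicClosure k))
      (isRadical_map (p := p) hrad)
      (fun Q hQ ↦ hasDim_of_mem_minimalPrimes_extendScalars hdim hQ) m
    rwa [hilbertFunction_extendScalars, degree_extendScalars] at h
  · exact hilbertFunction_le_of_infinite hI hrad hdim m

end Unmixed

end HomogeneousIdeals

theorem theorem2p2 {k : Type*} [Field k] [PerfectField k] {n d : ℕ}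
    (I : Ideal (MvPolynomial (Fin (n + 1)) k))
    (hhom : HomogeneousIdeals.IsHomogeneousIdeal I)
    (hunmixed : HomogeneousIdeals.IsUnmixed I)
    (hrad : I.IsRadical)
    (hdim : HomogeneousIdeals.HasDim I d)
    (m : ℕ) (hm : 1 ≤ m) :
    (HomogeneousIdeals.hilbertFunction I m : ℤ) ≤
      ((m + HomogeneousIdeals.degree I d + d).choose (d + 1) : ℤ) -
        ((m + d).choose (d + 1) : ℤ) := by
  have h := HomogeneousIdeals.hilbertFunction_le_sum_choose hhom hrad
    (fun P hP ↦ hunmixed.hasDim_of_mem_minimalPrimes hdim hP) m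
  rw [← HomogeneousIdeals.sum_choose_add_choose d m]
  push_cast
  rw [add_sub_cancel_right]
  exact_mod_cast h
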